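/- Let $X$ be a measurable space, $\mu$ a probability measure on $X$, and $p(\cdot\mid x)$, $q(\cdot\mid x)$ probability kernels from $X$ to $\mathbb{R}$ with $p(\cdot\mid x)\ll q(\cdot\mid x)$ for $\mu$-almost every $x$. Let $Q(dx,dy)=\mu(dx)\,q(dy\mid x)$ be the sampling distribution and $P(dx,dy)=\mu(dx)\,p(dy\mid x)$ the target distribution, let $w(x,y)=\frac{p(y\mid x)}{q(y\mid x)}$ (the density of $p(\cdot\mid x)$ with respect to $q(\cdot\mid x)$), and assume $|Y|\le F_{\max}$ $Q$-almost surely, where $0<F_{\max}<\infty$. Let $\mathcal H$ be a class of measurable functions $f:X\to\mathbb{R}$ with $|f|\le F_{\max}$ everywhere, and let $\widetilde w:X\times\mathbb{R}\to(0,\infty)$ be any measurable function with $\mathbb{E}_Q[\widetilde w(X,Y)^2]<\infty$. Assume that the class of functions $\{(x,y)\mapsto|f(x)-y|^2: f\in\mathcal H\}$ on $X\times\mathbb{R}$ has finite pseudo-dimension $d$ (the largest number of points $z_1,\dots,z_n$ for which there are thresholds $t_1,\dots,t_n\in\mathbb{R}$ such that every pattern of truth values of the conditions $u(z_i)\ge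 t_i$, $i=1,\dots,n$, is realized by some $u$ in the class). Let $\mathcal D=\{(x_i,y_i)\}_{i=1}^N$, $N\ge1$, be i.i.d. samples from $Q$, with $d\le 2N$, let $\widehat{\mathbb E}_{\mathcal D}[\varphi(X,Y)]=\frac1N\sum_{i=1}^N\varphi(x_i,y_i)$, and let $\widehat h=\widehat h_{\mathcal D}$ be a weighted empirical risk minimizer, $\widehat h\in\operatorname{argmin}_{f\in\mathcal H}\widehat{\mathbb E}_{\mathcal D}\big[\widetilde w(X,Y)|f(X)-Y|^2\big]$ for almost every $\mathcal D$, such that $(\mathcal D,x)\mapsto\widehat h_{\mathcal D}(x)$ is measurable. Put $h^*(x)=\mathbb{E}_p[Y\mid x]$, $g(x)=\mathbb{E}_q[\widetilde w(x,Y)\mid x]-1$, and $$M(\widetilde w)=\sqrt{\mathbb{E}_Q[\widetilde w(X,Y)^2]}+\sqrt{\widehat{\mathbb E}_{\mathcal D}[\widetilde w(X,Y)^2]}.$$ Then for every $\delta>0$, with probability at least $1-2\delta$, $$\|\widehat h-h^*\|_\mu\le\inf_{f\in\mathcal H}\|f-h^*\|_\mu+F_{\max}\sqrt{\|g\|_{1,\mu}}+2^{13/8}F_{\max}\sqrt{M(\widetilde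 w)}\left(\frac{d\log\frac{2Ne}{d}+\log\frac4\delta}{N}\right)^{3/16}+2F_{\max}\|\widetilde w-w\|_Q,$$ where $\|\cdot\|_{1,\mu}$ is the $L^1(\mu)$-norm, $\|\cdot\|_\mu$ and $\|\cdot\|_Q$ are the $L^2$-norms (the last term may be $+\infty$), and $d\log\frac{2Ne}{d}$ is read as $0$ for $d=0$. -/

import Mathlib

open MeasureTheory ProbabilityTheory

namespace WeightedRegression

noncomputable section

/-- The space `B(X, L)` of measurable real functions on `X` that are bounded by `L`. -/
def boundedMeasurable (X : Type*) [MeasurableSpace X] (L : ℝ) : Set (X → ℝ) :=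
  {f | Measurable f ∧ ∀ x, |f x| ≤ L}

/-- A finite set `s` is pseudo-shattered by the class `U` of real functions if for some thresholds
`t` every subset of `s` is cut out of `s` by `{z | t z ≤ u z}` for some `u ∈ U`. -/
def PseudoShatters {Z : Type*} (U : Set (Z → ℝ)) (s : Finset Z) : Prop :=
  ∃ t : Z → ℝ, ∀ A ⊆ s, ∃ u ∈ U, ∀ z ∈ s, (t z ≤ u z ↔ z ∈ A)

/-- The pseudo-dimension of a class of real functions: the supremum of the cardinalities of the
finite sets that it pseudo-shatters. -/
def pseudoDim {Z : Type*} (U : Set (Z → ℝ)) : ℕ∞ :=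
  ⨆ (s : Finset Z) (_ : PseudoShatters U s), (s.card : ℕ∞)

/-- The squared loss `(x, y) ↦ |f x - y|²` of a hypothesis `f`. -/
def squaredLoss {X : Type*} (f : X → ℝ) (z : X × ℝ) : ℝ := |f z.1 - z.2| ^ 2

/-- The empirical expectation of `φ` on the dataset `D`. -/
def empiricalMean {Z : Type*} {N : ℕ} (D : Fin N → Z) (φ : Z → ℝ) : ℝ :=
  (1 / (N : ℝ)) * ∑ i, φ (D i)

/-- `h` minimizes the empirical weighted squared loss over `H`. -/
def IsWeightedERM {X : Type*} {N : ℕ} (H : Set (X → ℝ)) (v : X × ℝ → ℝ) (D : Fin N → X × ℝ)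
    (h : X → ℝ) : Prop :=
  h ∈ H ∧ ∀ f ∈ H, empiricalMean D (fun z => v z * squaredLoss h z) ≤
    empiricalMean D (fun z => v z * squaredLoss f z)

/-- The law of a pair `(X, Y)` with `X ∼ μ` and `Y | X = x ∼ κ x`. -/
abbrev jointLaw {X : Type*} [MeasurableSpace X] (μ : Measure X) (κ : Kernel X ℝ) :
    Measure (X × ℝ) :=
  μ.compProd κ

/-- The importance weight `w (x, y) = p (y | x) / q (y | x)`: the density of the conditional law
`p x` with respect to the conditional law `q x`. -/
def importanceWeight {X : Type*} [MeasurableSpace X] (p q : Kernel X ℝ) (z : X × ℝ) : ℝ :=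
  (Kernel.rnDeriv p q z.1 z.2).toReal

/-- The regression function `x ↦ E_p[Y | x]`. -/
def regressionFunction {X : Type*} [MeasurableSpace X] (p : Kernel X ℝ) (x : X) : ℝ :=
  ∫ y, y ∂(p x)

/-- The conditional bias `g x = E_q[v (x, Y) | x] - 1` of the weights `v`. -/
def weightBias {X : Type*} [MeasurableSpace X] (q : Kernel X ℝ) (v : X × ℝ → ℝ) (x : X) : ℝ :=
  (∫ y, v (x, y) ∂(q x)) - 1

/-- `M v = √(E_Q[v²]) + √(Ê_D[v²])`. -/
def momentTerm {Z : Type*} [MeasurableSpace Z] {N : ℕ} (Q : Measure Z) (v : Z → ℝ)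
    (D : Fin N → Z) : ℝ :=
  √(∫ z, v z ^ 2 ∂Q) + √(empiricalMean D (fun z => v z ^ 2))

/-- `(d log (2 N e / d) + log (4 / δ)) / N`; for `d = 0` the first summand is `0`. -/
def complexityTerm (d N : ℕ) (δ : ℝ) : ℝ :=
  ((d : ℝ) * Real.log (2 * (N : ℝ) * Real.exp 1 / (d : ℝ)) + Real.log (4 / δ)) / (N : ℝ)

end

end WeightedRegression

/-! Write `w̃` for the given weights, `F` for the bound and `r x = E_q[w̃ Y | x]`. Since `E_q[w̃ |
x] = 1 + g x`, the excess weighted risk of `h` over `f` is `‖h - r‖² - ‖f - r‖² + ∫ (h² - f²) g dμ`,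
and `|h² - f²| ≤ F²`. An excess of at most `4F²τ` therefore gives `‖h - r‖ ≤ ‖f - r‖ + F√‖g‖₁ +
2F√τ`. Because `h* x = E_q[w Y | x]`, Jensen's inequality gives `‖r - h*‖ ≤ F‖w̃ - w‖`, and passing
from `r` to `h*` on both sides costs this twice (`eLpNorm_sub_regressionFunction_le`).

The probabilistic core is `weighted_erm_deviation`, with `τ = 2^(5/4) C^(3/8) M` and `C` the
complexity term, for losses rescaled to `[0, 1]`. The weights are unbounded, so the deviation is
measured against their empirical second moment. If the minimizer has empirical excess at most `0`
but a large true excess, an independent ghost sample reveals the gap with probability at least `1/6`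
(`ghost_sample_bound`). Exchanging sample points in pairs preserves the law of the double sample and
its total of squared weights. For each fixed double sample, Hoeffding's inequality for the random
exchanges and a union bound over the quantized loss patterns, counted by Sauer's lemma, bound the
proportion of exchanges with a large gap (`card_swaps_le`).

This produces a deviation of order `√C`. It is absorbed into `C^(3/8)` by `threshold_le`, which
needs the lower tail `measure_sum_le_exp` of the sum of the weights; where `2^(5/4) C^(3/8) ≥ 1` the
bound is trivial. Finally, the infimum over competitors is approached along an increasing sequence
of failure events, at no cost in probability. -/

namespace WeightedRegression

/-! ### Quantized loss patterns and Sauer's lemma. -/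

/-- The Sauer–Shelah sum is at most `(e n / d) ^ d`. -/
theorem sum_choose_le_pow {n d : ℕ} (hd : 0 < d) (hdn : d ≤ n) :
    (∑ k ∈ Finset.Iic d, (n.choose k : ℝ)) ≤ (n * Real.exp 1 / d) ^ d := by
  have hd' : (0 : ℝ) < d := by exact_mod_cast hd
  have hn' : (0 : ℝ) < n := by exact_mod_cast hd.trans_le hdn
  have hdn' : (d : ℝ) ≤ n := by exact_mod_cast hdn
  have hx1 : (1 : ℝ) ≤ n / d := (one_le_div hd').2 hdn'
  have h1 : (∑ k ∈ Finset.Iic d, (n.choose k : ℝ)) ≤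
      (n / d : ℝ) ^ d * ∑ k ∈ Finset.range (n + 1), (d / n : ℝ) ^ k * (n.choose k : ℝ) := by
    rw [Finset.mul_sum]
    refine (Finset.sum_le_sum (g := fun k => (n / d : ℝ) ^ d * ((d / n : ℝ) ^ k * n.choose k))
      fun k hk => ?_).trans (Finset.sum_le_sum_of_subset_of_nonneg ?_ fun _ _ _ => by positivity)
    · have hk : k ≤ d := Finset.mem_Iic.1 hk
      rw [← mul_assoc]
      refine le_mul_of_one_le_left (by positivity) ?_
      have : (d / n : ℝ) ^ k = ((n / d : ℝ) ^ k)⁻¹ := by rw [← inv_pow, inv_div]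
      rw [this, ← div_eq_mul_inv, one_le_div (by positivity)]
      exact pow_le_pow_right₀ hx1 hk
    · intro k hk
      have hk : k ≤ d := Finset.mem_Iic.1 hk
      exact Finset.mem_range.2 (by omega)
  refine h1.trans ?_
  have h2 : ∑ k ∈ Finset.range (n + 1), (d / n : ℝ) ^ k * (n.choose k : ℝ)
      = (d / n + 1 : ℝ) ^ n := by
    rw [add_pow]; simp
  rw [h2, mul_div_right_comm, mul_pow, ← Real.exp_nat_mul]
  gcongr
  calc (d / n + 1 : ℝ) ^ n ≤ Real.exp (d / n) ^ n := by
        gcongr; exact Real.add_one_le_exp _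
    _ = Real.exp (d * 1) := by
        rw [← Real.exp_nat_mul]; congr 1; field_simp

/-- The cells `(i, j)` with `(j + 1) / K ≤ a i`. -/
noncomputable def levelPattern {ι : Type*} [Fintype ι] (K : ℕ) (a : ι → ℝ) : Finset (ι × Fin K) :=
  Finset.univ.filter fun c => (c.2 : ℕ) + 1 ≤ ⌊K * a c.1⌋₊

/-- The function with values in `(1 / K) ℕ` obtained from `u` by rounding down. -/
noncomputable def quantize {Z : Type*} (K : ℕ) (u : Z → ℝ) (z : Z) : ℝ := (⌊K * u z⌋₊ : ℝ) / K

theorem quantize_nonneg {Z : Type*} (K : ℕ) (u : Z → ℝ) (z : Z) : 0 ≤ quantize K u z := by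
  unfold quantize; positivity

theorem quantize_le {Z : Type*} {K : ℕ} (hK : 0 < K) {u : Z → ℝ} {z : Z} (h0 : 0 ≤ u z) :
    quantize K u z ≤ u z := by
  have hK' : (0 : ℝ) < K := by exact_mod_cast hK
  rw [quantize, div_le_iff₀ hK', mul_comm]
  exact Nat.floor_le (by positivity)

theorem le_quantize_add {Z : Type*} {K : ℕ} (hK : 0 < K) (u : Z → ℝ) (z : Z) :
    u z ≤ quantize K u z + 1 / K := by
  have hK' : (0 : ℝ) < K := by exact_mod_cast hK
  rw [quantize, ← add_div, le_div_iff₀ hK', mul_comm]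
  exact (Nat.lt_floor_add_one _).le

/-- The quantized values on a finite sample can be read off the level pattern. -/
theorem quantize_eq_card {ι Z : Type*} [Fintype ι] [DecidableEq ι] {K : ℕ} {u : Z → ℝ}
    (z : ι → Z) (i : ι) (h1 : u (z i) ≤ 1) :
    quantize K u (z i) =
      ((Finset.univ.filter fun j : Fin K => (i, j) ∈ levelPattern K (u ∘ z)).card : ℝ) / K := by
  have hn : ⌊K * u (z i)⌋₊ ≤ K := by
    refine Nat.floor_le_of_le ?_
    calc (K : ℝ) * u (z i) ≤ K * 1 := by gcongr
      _ = K := mul_one _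
  simp only [quantize, levelPattern, Finset.mem_filter, Finset.mem_univ, true_and,
    Function.comp_apply]
  congr 2
  have : (Finset.univ.filter fun j : Fin K => (j : ℕ) + 1 ≤ ⌊K * u (z i)⌋₊).map Fin.valEmbedding
      = Finset.range ⌊K * u (z i)⌋₊ := by
    ext j
    simp only [Finset.mem_map, Finset.mem_filter, Finset.mem_univ, true_and, Fin.valEmbedding_apply,
      Finset.mem_range]
    constructor
    · rintro ⟨a, ha, rfl⟩; omega
    · intro hj; exact ⟨⟨j, by omega⟩, by simpa using hj, rfl⟩
  rw [← Finset.card_map Fin.valEmbedding, this, Finset.card_range]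

theorem card_le_of_pseudoShatters {Z : Type*} {U : Set (Z → ℝ)} {d : ℕ}
    (hU : pseudoDim U ≤ d) {s : Finset Z} (hs : PseudoShatters U s) : s.card ≤ d := by
  have h : (s.card : ℕ∞) ≤ pseudoDim U := by
    unfold pseudoDim
    exact le_iSup₂ (f := fun (s : Finset Z) (_ : PseudoShatters U s) => (s.card : ℕ∞)) s hs
  exact_mod_cast h.trans hU

open Classical in
/-- The level patterns of the members of `U` on the sample `z`. -/
noncomputable def levelPatterns {ι Z : Type*} [Fintype ι] (K : ℕ) (U : Set (Z → ℝ)) (z : ι → Z) :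
    Finset (Finset (ι × Fin K)) :=
  Finset.univ.filter fun A => ∃ u ∈ U, levelPattern K (u ∘ z) = A

-- Each cell is a sample point with a threshold `(j + 1)/K`, so shattering cells by level patterns
-- is pseudo-shattering the points under them, provided that no point carries two cells.
open Classical in
theorem card_le_of_shatters_levelPatterns {ι Z : Type*} [Fintype ι] {K : ℕ}
    {U : Set (Z → ℝ)} {d : ℕ} (hU : pseudoDim U ≤ d) (z : ι → Z) {T : Finset (ι × Fin K)}
    (hT : (levelPatterns K U z).Shatters T) : T.card ≤ d := by
  have key : ∀ A ⊆ T, ∃ u ∈ U, ∀ c ∈ T, (((c.2 : ℕ) + 1 : ℕ) : ℝ) ≤ K * u (z c.1) ↔ c ∈ A := by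
    intro A hA
    obtain ⟨B, hB, hBA⟩ := hT hA
    simp only [levelPatterns, Finset.mem_filter, Finset.mem_univ, true_and] at hB
    obtain ⟨u, hu, rfl⟩ := hB
    refine ⟨u, hu, fun c hc => ?_⟩
    rw [← hBA, Finset.mem_inter, ← Nat.le_floor_iff' (Nat.succ_ne_zero _)]
    simp [levelPattern, hc]
  -- Levels over one point are nested: reaching the higher one forces the lower one, so the pattern
  -- consisting of the higher cell alone cannot occur. Comparing the values `z c.1` also covers
  -- repeated sample points.
  have hinj : Set.InjOn (fun c : ι × Fin K => z c.1) T := by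
    intro a ha b hb hab
    wlog hle : (a.2 : ℕ) ≤ b.2 generalizing a b with H
    · exact (H hb ha hab.symm (by omega)).symm
    by_contra hne
    obtain ⟨u, -, hu⟩ := key {b} (by simpa using hb)
    have hb' := (hu b hb).2 (by simp)
    have ha' := (hu a ha).not.2 (by simpa using hne)
    refine ha' (le_trans ?_ ((show z a.1 = z b.1 from hab) ▸ hb'))
    exact_mod_cast Nat.succ_le_succ hle
  rw [← Finset.card_image_of_injOn hinj]
  refine card_le_of_pseudoShatters hU ?_
  have hex : ∀ x : Z, ∃ c : Option (ι × Fin K), ∀ a ∈ T, z a.1 = x → c = some a := by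
    intro x
    by_cases h : ∃ a ∈ T, z a.1 = x
    · obtain ⟨a, ha, hax⟩ := h
      exact ⟨some a, fun b hb hbx => congrArg some (hinj ha hb (hax.trans hbx.symm))⟩
    · exact ⟨none, fun a ha hax => (h ⟨a, ha, hax⟩).elim⟩
  choose cell hcell using hex
  refine ⟨fun x => ((cell x).elim 0 fun c => (((c.2 : ℕ) + 1 : ℕ) : ℝ)) / K, fun A hA => ?_⟩
  obtain ⟨u, hu, hT'⟩ := key (T.filter fun c => z c.1 ∈ A) (Finset.filter_subset _ _)
  refine ⟨u, hu, fun x hx => ?_⟩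
  obtain ⟨c, hc, rfl⟩ := Finset.mem_image.1 hx
  have hK : (0 : ℝ) < K := by exact_mod_cast (Nat.zero_le _).trans_lt c.2.2
  beta_reduce
  rw [hcell _ c hc rfl, Option.elim_some, div_le_iff₀' hK, hT' c hc]
  simp [hc]

/-- Sauer's bound for the number of level patterns of a class of finite pseudo-dimension. -/
theorem card_levelPatterns_le {ι Z : Type*} [Fintype ι] {K : ℕ}
    {U : Set (Z → ℝ)} {d : ℕ} (hU : pseudoDim U ≤ d) (z : ι → Z) (hd : 0 < d)
    (hdn : d ≤ Fintype.card ι * K) :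
    ((levelPatterns K U z).card : ℝ) ≤ ((Fintype.card ι * K : ℕ) * Real.exp 1 / d) ^ d := by
  classical
  refine le_trans ?_ (sum_choose_le_pow hd hdn)
  have h1 : (levelPatterns K U z).vcDim ≤ d := by
    refine Finset.sup_le fun T hT => card_le_of_shatters_levelPatterns hU z ?_
    simpa using hT
  have h2 := (Finset.card_le_card_shatterer (levelPatterns K U z)).trans
    Finset.card_shatterer_le_sum_vcDim
  rw [Fintype.card_prod, Fintype.card_fin] at h2
  have h3 : (levelPatterns K U z).card ≤
      ∑ k ∈ Finset.Iic d, (Fintype.card ι * K).choose k :=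
    h2.trans (Finset.sum_le_sum_of_subset (Finset.Iic_subset_Iic.2 h1))
  exact_mod_cast h3

/-! ### Random signs and exchanges of a double sample. -/

/-- The sign `±1` attached to a Boolean. -/
def boolSign (b : Bool) : ℝ := if b then -1 else 1

/-- Hoeffding's inequality for sums with random signs, as a count of sign vectors. -/
theorem card_signs_le {N : ℕ} (c : Fin N → ℝ) {v l : ℝ} (hv : 0 < v) (hl : 0 ≤ l)
    (hc : ∑ i, c i ^ 2 ≤ 2 * v) :
    ((Finset.univ.filter fun ε : Fin N → Bool =>
      2 * √(l * v) < ∑ i, boolSign (ε i) * c i).card : ℝ) ≤ 2 ^ N * Real.exp (-l) := by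
  -- The optimal Chernoff parameter: the exponent at the threshold is `2l`, while the moment
  -- generating function contributes at most `e^l`.
  set r := √(l / v) with hr
  have hr0 : 0 ≤ r := Real.sqrt_nonneg _
  have hr2 : r ^ 2 * v = l := by
    rw [hr, Real.sq_sqrt (by positivity)]; field_simp
  have hrv : r * √(l * v) = l := by
    rw [hr, ← Real.sqrt_mul (by positivity), show l / v * (l * v) = l ^ 2 by field_simp,
      Real.sqrt_sq hl]
  have h1 : ((Finset.univ.filter fun ε : Fin N → Bool =>
      2 * √(l * v) < ∑ i, boolSign (ε i) * c i).card : ℝ) * Real.exp (2 * l) ≤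
      ∑ ε : Fin N → Bool, ∏ i, Real.exp (boolSign (ε i) * (r * c i)) := by
    rw [← nsmul_eq_mul]
    refine (Finset.card_nsmul_le_sum _ (fun ε : Fin N → Bool =>
      ∏ i, Real.exp (boolSign (ε i) * (r * c i))) _ ?_).trans
      (Finset.sum_le_sum_of_subset_of_nonneg (Finset.filter_subset _ _)
        fun _ _ _ => Finset.prod_nonneg fun _ _ => (Real.exp_pos _).le)
    intro ε hε
    have hε := (Finset.mem_filter.1 hε).2
    rw [← Real.exp_sum, Real.exp_le_exp]
    calc 2 * l = r * (2 * √(l * v)) := by linarith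
      _ ≤ r * ∑ i, boolSign (ε i) * c i := by gcongr
      _ = _ := by rw [Finset.mul_sum]; exact Finset.sum_congr rfl fun _ _ => by ring
  have h2 : ∑ ε : Fin N → Bool, ∏ i, Real.exp (boolSign (ε i) * (r * c i)) =
      ∏ i, ∑ b : Bool, Real.exp (boolSign b * (r * c i)) := by
    rw [Finset.prod_univ_sum, Fintype.piFinset_univ]
  have h3 : ∏ i, ∑ b : Bool, Real.exp (boolSign b * (r * c i)) ≤ 2 ^ N * Real.exp l := by
    calc ∏ i, ∑ b : Bool, Real.exp (boolSign b * (r * c i))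
        ≤ ∏ i : Fin N, 2 * Real.exp ((r * c i) ^ 2 / 2) := by
          refine Finset.prod_le_prod (fun _ _ => by positivity) fun i _ => ?_
          have := Real.cosh_le_exp_half_sq (r * c i)
          rw [Real.cosh_eq] at this
          simp only [Fintype.sum_bool, boolSign, if_true]
          norm_num
          linarith
      _ = 2 ^ N * Real.exp (∑ i, (r * c i) ^ 2 / 2) := by
          rw [Finset.prod_mul_distrib, ← Real.exp_sum]; simp
      _ ≤ 2 ^ N * Real.exp l := by
          gcongr
          calc ∑ i, (r * c i) ^ 2 / 2 = r ^ 2 * (∑ i, c i ^ 2) / 2 := by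
                rw [Finset.mul_sum, Finset.sum_div]
                exact Finset.sum_congr rfl fun _ _ => by ring
            _ ≤ r ^ 2 * (2 * v) / 2 := by gcongr
            _ = l := by linarith
  have h4 := h1.trans (h2.le.trans h3)
  have : Real.exp (2 * l) = Real.exp l * Real.exp l := by rw [← Real.exp_add]; ring_nf
  rw [this, ← mul_assoc] at h4
  rw [Real.exp_neg, ← div_eq_mul_inv, le_div_iff₀ (Real.exp_pos l)]
  exact le_of_mul_le_mul_right h4 (Real.exp_pos l)

/-- Exchange the two members of the `i`-th pair for the indices `i` with `ε i`. -/
def swapPairs {N : ℕ} {Z : Type*} (ε : Fin N → Bool) (E : Fin N → Z × Z) : Fin N → Z × Z :=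
  fun i => if ε i then (E i).swap else E i

/-- The difference of the sums of `φ` over the second and over the first sample. -/
def sampleGap {N : ℕ} {Z : Type*} (φ : Z → ℝ) (E : Fin N → Z × Z) : ℝ :=
  ∑ i, (φ (E i).2 - φ (E i).1)

/-- The sum of `φ` over both samples. -/
def sampleTotal {N : ℕ} {Z : Type*} (φ : Z → ℝ) (E : Fin N → Z × Z) : ℝ :=
  ∑ i, (φ (E i).1 + φ (E i).2)

theorem sampleTotal_swapPairs {N : ℕ} {Z : Type*} (φ : Z → ℝ) (ε : Fin N → Bool)
    (E : Fin N → Z × Z) : sampleTotal φ (swapPairs ε E) = sampleTotal φ E := by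
  refine Finset.sum_congr rfl fun i _ => ?_
  by_cases h : ε i <;> simp [swapPairs, h, add_comm]

theorem sampleGap_swapPairs {N : ℕ} {Z : Type*} (φ : Z → ℝ) (ε : Fin N → Bool)
    (E : Fin N → Z × Z) :
    sampleGap φ (swapPairs ε E) = ∑ i, boolSign (ε i) * (φ (E i).2 - φ (E i).1) := by
  refine Finset.sum_congr rfl fun i _ => ?_
  by_cases h : ε i <;> simp [swapPairs, h, boolSign]

open Classical in
/-- For a class of functions with values in `[0, 1]`, few exchanges of a double sample produce a
large gap between the two samples for some quantized member of the class. -/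
theorem card_swaps_le {N : ℕ} {Z : Type*} (hN : 0 < N) {w : Z → ℝ} (hw : ∀ z, 0 < w z)
    {U : Set (Z → ℝ)} (hU01 : ∀ u ∈ U, ∀ z, u z ∈ Set.Icc (0 : ℝ) 1) {d K : ℕ}
    (hU : pseudoDim U ≤ d) (hd : 0 < d) (hK : 0 < K) (hdN : d ≤ 2 * N)
    {u₀ : Z → ℝ} (hu₀ : u₀ ∈ U) {l : ℝ} (hl : 0 ≤ l) (E : Fin N → Z × Z) :
    ((Finset.univ.filter fun ε : Fin N → Bool => ∃ u ∈ U,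
      2 * √(l * sampleTotal (fun z => w z ^ 2) (swapPairs ε E)) <
        sampleGap (fun z => w z * (quantize K u z - u₀ z)) (swapPairs ε E)).card : ℝ) ≤
      2 ^ N * ((2 * N * K * Real.exp 1 / d) ^ d * Real.exp (-l)) := by
  set z : Fin N × Bool → Z := fun c => if c.2 then (E c.1).2 else (E c.1).1 with hz
  set v := sampleTotal (fun z => w z ^ 2) E with hv
  have hv0 : 0 < v := by
    have : Nonempty (Fin N) := ⟨⟨0, hN⟩⟩
    exact Finset.sum_pos (fun i _ => add_pos (pow_pos (hw _) 2) (pow_pos (hw _) 2))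
      Finset.univ_nonempty
  -- The weighted differences depend on `u` only through its level pattern, which makes the union
  -- bound over `u ∈ U` finite.
  let val : Finset ((Fin N × Bool) × Fin K) → Fin N × Bool → ℝ := fun A c =>
    w (z c) * (((Finset.univ.filter fun j : Fin K => (c, j) ∈ A).card : ℝ) / K - u₀ (z c))
  have hval : ∀ u ∈ U, ∀ c, val (levelPattern K (u ∘ z)) c
      = w (z c) * (quantize K u (z c) - u₀ (z c)) := by
    intro u hu c
    simp only [val]
    rw [quantize_eq_card z c (hU01 u hu _).2]
  have hsub : (Finset.univ.filter fun ε : Fin N → Bool => ∃ u ∈ U,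
      2 * √(l * sampleTotal (fun z => w z ^ 2) (swapPairs ε E)) <
        sampleGap (fun z => w z * (quantize K u z - u₀ z)) (swapPairs ε E)) ⊆
      (levelPatterns K U z).biUnion fun A => Finset.univ.filter fun ε : Fin N → Bool =>
        2 * √(l * v) < ∑ i, boolSign (ε i) * (val A (i, true) - val A (i, false)) := by
    intro ε hε
    obtain ⟨u, hu, h⟩ := (Finset.mem_filter.1 hε).2
    rw [sampleTotal_swapPairs, sampleGap_swapPairs] at h
    refine Finset.mem_biUnion.2 ⟨levelPattern K (u ∘ z), ?_, ?_⟩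
    · simp only [levelPatterns, Finset.mem_filter, Finset.mem_univ, true_and]
      exact ⟨u, hu, rfl⟩
    · refine Finset.mem_filter.2 ⟨Finset.mem_univ _, h.trans_le (le_of_eq ?_)⟩
      refine Finset.sum_congr rfl fun i _ => ?_
      rw [hval u hu, hval u hu]
      simp [hz]
  have hA : ∀ A ∈ levelPatterns K U z, ((Finset.univ.filter fun ε : Fin N → Bool =>
        2 * √(l * v) < ∑ i, boolSign (ε i) * (val A (i, true) - val A (i, false))).card : ℝ) ≤
        2 ^ N * Real.exp (-l) := by
    intro A hA
    simp only [levelPatterns, Finset.mem_filter, Finset.mem_univ, true_and] at hA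
    obtain ⟨u, hu, rfl⟩ := hA
    refine card_signs_le _ hv0 hl ?_
    have hb : ∀ c, |val (levelPattern K (u ∘ z)) c| ≤ w (z c) := by
      intro c
      rw [hval u hu, abs_mul, abs_of_pos (hw _)]
      refine mul_le_of_le_one_right (hw _).le (abs_le.2 ⟨?_, ?_⟩)
      · linarith [quantize_nonneg K u (z c), (hU01 u₀ hu₀ (z c)).2]
      · linarith [quantize_le hK (hU01 u hu (z c)).1, (hU01 u hu (z c)).2,
          (hU01 u₀ hu₀ (z c)).1]
    -- From `(a - b)² ≤ 2(a² + b²)`: the variance proxy of the signed sum is controlled by the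
    -- exchange-invariant total of the squared weights.
    rw [hv, sampleTotal, Finset.mul_sum]
    refine Finset.sum_le_sum fun i _ => ?_
    have h1 := sq_le_sq' (neg_le_of_abs_le (hb (i, true))) (le_of_abs_le (hb (i, true)))
    have h2 := sq_le_sq' (neg_le_of_abs_le (hb (i, false))) (le_of_abs_le (hb (i, false)))
    have e1 : z (i, true) = (E i).2 := by simp [hz]
    have e2 : z (i, false) = (E i).1 := by simp [hz]
    rw [e1] at h1
    rw [e2] at h2
    nlinarith [sq_nonneg (val (levelPattern K (u ∘ z)) (i, true) +
      val (levelPattern K (u ∘ z)) (i, false))]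
  have hcard := card_levelPatterns_le (K := K) hU z hd (by
    simp only [Fintype.card_prod, Fintype.card_fin, Fintype.card_bool]; nlinarith)
  calc _ ≤ (((levelPatterns K U z).biUnion fun A => Finset.univ.filter fun ε : Fin N → Bool =>
        2 * √(l * v) < ∑ i, boolSign (ε i) * (val A (i, true) - val A (i, false))).card : ℝ) := by
        exact_mod_cast Finset.card_le_card hsub
    _ ≤ ∑ A ∈ levelPatterns K U z, ((Finset.univ.filter fun ε : Fin N → Bool =>
        2 * √(l * v) < ∑ i, boolSign (ε i) * (val A (i, true) - val A (i, false))).card : ℝ) := by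
        exact_mod_cast Finset.card_biUnion_le
    _ ≤ (levelPatterns K U z).card * (2 ^ N * Real.exp (-l)) := by
        rw [← nsmul_eq_mul]; exact Finset.sum_le_card_nsmul _ _ _ hA
    _ ≤ (2 * N * K * Real.exp 1 / d) ^ d * (2 ^ N * Real.exp (-l)) := by
        gcongr
        refine hcard.trans (le_of_eq ?_)
        simp only [Fintype.card_prod, Fintype.card_fin, Fintype.card_bool]
        push_cast
        ring
    _ = _ := by ring

/-! ### The numerical inequality turning `√C` into `C^(3/8)`. -/

section

/-- Here `v` stands for `C^(1/8)`. The conclusion holds for small `v`; `h1` bounds `v` from above,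
and `h2` excludes small `s` when `v` is not small. -/
theorem threshold_aux {v s : ℝ} (hv : 0 < v) (hs : 0 ≤ s)
    (h1 : 2.378 * v ^ 3 * (1 + s) < 1) (h2 : 2.378 * v ^ 3 * (1 + s) < s + 1.4143 * v ^ 4) :
    v * (1.7072 + 2.4495 * √(s ^ 2 + 2)) ≤ 2.378 * (1 + s) := by
  have hv3 : 0 < v ^ 3 := by positivity
  rcases le_or_gt 1 s with h | h
  · have hr : √(s ^ 2 + 2) ≤ s + 0.7321 := by
      rw [Real.sqrt_le_left (by linarith)]; nlinarith
    have hv' : v ≤ 0.596 := by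
      by_contra! hc
      have : (0.596 : ℝ) ^ 3 < v ^ 3 := by gcongr
      nlinarith
    nlinarith [Real.sqrt_nonneg (s ^ 2 + 2)]
  · have hr : √(s ^ 2 + 2) ≤ 1.4143 + 0.318 * s := by
      rw [Real.sqrt_le_left (by linarith)]; nlinarith
    have hv' : v ≤ 0.75 := by
      by_contra! hc
      have : (0.75 : ℝ) ^ 3 < v ^ 3 := by gcongr
      nlinarith
    suffices v * (5.172 + 0.78 * s) ≤ 2.378 * (1 + s) by
      exact (mul_le_mul_of_nonneg_left (by linarith) hv.le).trans this
    by_contra! hc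
    have hvc : ∀ a c : ℝ, 0 ≤ c → c ≤ 1 → a ≤ s → c * (5.172 + 0.78 * a) ≤ 2.378 * (1 + a) →
        c ^ 3 ≤ v ^ 3 := by
      intro a c hc0 hc1 ha h
      have : c ≤ v := by
        by_contra! hlt
        nlinarith
      gcongr
    -- A bootstrap under the assumption that the conclusion fails: `s ≥ a` forces `v ≥ c`, and then
    -- `h2` forces `s ≥ b`. Iterating from `a = 0` raises `s` to `0.54` and `v` to `0.654`, which
    -- contradicts `h1`.
    have step : ∀ a c b : ℝ, 0 ≤ c → c ≤ 1 → 0 ≤ a → a ≤ s →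
        c * (5.172 + 0.78 * a) ≤ 2.378 * (1 + a) →
        b ≤ c ^ 3 * (2.378 * (1 + a) - 1.0608) → b ≤ s := by
      intro a c b hc0 hc1 ha0 ha h hb
      have h3 := hvc a c hc0 hc1 ha h
      have h4 : 1.4143 * v ^ 4 ≤ 1.0608 * v ^ 3 := by
        have : v ^ 4 = v ^ 3 * v := by ring
        nlinarith
      have h5 : c ^ 3 * (2.378 * (1 + a) - 1.0608) ≤ v ^ 3 * (2.378 * (1 + s) - 1.0608) :=
        mul_le_mul h3 (by linarith) (by linarith) hv3.le
      nlinarith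
    have s1 := step 0 0.4597 0.127 (by norm_num) (by norm_num) le_rfl hs (by norm_num) (by norm_num)
    have s2 := step _ 0.508 0.21 (by norm_num) (by norm_num) (by norm_num) s1 (by norm_num)
      (by norm_num)
    have s3 := step _ 0.539 0.28 (by norm_num) (by norm_num) (by norm_num) s2 (by norm_num)
      (by norm_num)
    have s4 := step _ 0.564 0.35 (by norm_num) (by norm_num) (by norm_num) s3 (by norm_num)
      (by norm_num)
    have s5 := step _ 0.589 0.43 (by norm_num) (by norm_num) (by norm_num) s4 (by norm_num)
      (by norm_num)
    have s6 := step _ 0.617 0.54 (by norm_num) (by norm_num) (by norm_num) s5 (by norm_num)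
      (by norm_num)
    have h7 := hvc _ 0.654 (by norm_num) (by norm_num) s6 (by norm_num)
    nlinarith

theorem threshold_le {C s : ℝ} (hC : 0 < C) (hs : 0 ≤ s)
    (h1 : 2 ^ (5 / 4 : ℝ) * C ^ (3 / 8 : ℝ) * (1 + s) < 1)
    (h2 : 2 ^ (5 / 4 : ℝ) * C ^ (3 / 8 : ℝ) * (1 + s) < s + √(2 * C)) :
    √C * (1 + √2 / 2 + 2 * √(3 / 2) * √(s ^ 2 + 2)) ≤
      2 ^ (5 / 4 : ℝ) * C ^ (3 / 8 : ℝ) * (1 + s) := by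
  have ha : (2.378 : ℝ) ≤ 2 ^ (5 / 4 : ℝ) := by
    refine le_of_pow_le_pow_left₀ (n := 4) (by norm_num) (by positivity) ?_
    rw [← Real.rpow_natCast, ← Real.rpow_natCast, ← Real.rpow_mul (by norm_num)]
    norm_num
  set v := C ^ (1 / 8 : ℝ) with hv
  have hv0 : 0 < v := by positivity
  have hv3 : C ^ (3 / 8 : ℝ) = v ^ 3 := by
    rw [hv, ← Real.rpow_natCast, ← Real.rpow_mul hC.le]; norm_num
  have hv4 : √C = v ^ 4 := by
    rw [hv, ← Real.rpow_natCast, ← Real.rpow_mul hC.le, Real.sqrt_eq_rpow]; norm_num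
  have h2' : √2 ≤ 1.4143 := by rw [Real.sqrt_le_left (by norm_num)]; norm_num
  have h3' : √(3 / 2) ≤ 1.22475 := by rw [Real.sqrt_le_left (by norm_num)]; norm_num
  rw [Real.sqrt_mul (by norm_num), hv4] at h2
  rw [hv3] at h1 h2 ⊢
  rw [hv4]
  have hle : 2.378 * v ^ 3 * (1 + s) ≤ 2 ^ (5 / 4 : ℝ) * v ^ 3 * (1 + s) := by gcongr
  have h4 : √2 * v ^ 4 ≤ 1.4143 * v ^ 4 := by gcongr
  have key := threshold_aux hv0 hs (by linarith) (by linarith)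
  refine le_trans ?_ hle
  calc v ^ 4 * (1 + √2 / 2 + 2 * √(3 / 2) * √(s ^ 2 + 2))
      ≤ v ^ 4 * (1.7072 + 2.4495 * √(s ^ 2 + 2)) := by
        have : √(3 / 2) * √(s ^ 2 + 2) ≤ 1.22475 * √(s ^ 2 + 2) := by gcongr
        gcongr v ^ 4 * ?_
        linarith
    _ = v ^ 3 * (v * (1.7072 + 2.4495 * √(s ^ 2 + 2))) := by ring
    _ ≤ v ^ 3 * (2.378 * (1 + s)) := by gcongr
    _ = _ := by ring

/-! ### Tail bounds, the ghost sample and symmetrization. -/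

/-- Follows from `(1 + x + x²/2)(1 - x + x²/2) = 1 + x⁴/4 ≥ 1`. It lets the lower tail of
nonnegative weights be handled with a second moment only. -/
theorem exp_neg_le_quadratic {x : ℝ} (hx : 0 ≤ x) : Real.exp (-x) ≤ 1 - x + x ^ 2 / 2 := by
  have h := Real.quadratic_le_exp_of_nonneg hx
  rw [Real.exp_neg, inv_le_comm₀ (Real.exp_pos x) (by nlinarith [sq_nonneg (x - 1)])]
  refine le_trans ?_ h
  rw [inv_le_iff_one_le_mul₀ (by nlinarith [sq_nonneg (x - 1)])]
  nlinarith [pow_nonneg hx 4, pow_nonneg hx 3]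

variable {Z : Type*} [MeasurableSpace Z]

/-- A nonnegative square integrable function has a sub-Gaussian lower tail. -/
theorem measure_sum_le_exp (Q : Measure Z) [IsProbabilityMeasure Q] {N : ℕ} {w : Z → ℝ}
    (hwm : Measurable w) (hw0 : ∀ z, 0 < w z) (hw2 : Integrable (fun z => w z ^ 2) Q)
    {t : ℝ} (ht : 0 ≤ t) :
    (Measure.pi fun _ : Fin N => Q)
      {D | ∑ i, w (D i) ≤ N * (∫ z, w z ∂Q - √(∫ z, w z ^ 2 ∂Q) * √(2 * t))} ≤
      ENNReal.ofReal (Real.exp (-(N * t))) := by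
  set m := ∫ z, w z ∂Q
  set σ := √(∫ z, w z ^ 2 ∂Q) with hσ
  have hw1 : Integrable w Q :=
    ((memLp_two_iff_integrable_sq hwm.aestronglyMeasurable).2 hw2).integrable one_le_two
  have hpos : 0 < ∫ z, w z ^ 2 ∂Q := by
    rw [integral_pos_iff_support_of_nonneg (fun z => sq_nonneg _) hw2]
    have : Function.support (fun z => w z ^ 2) = Set.univ := by
      ext z; simp [(hw0 z).ne']
    simp [this]
  have hσ0 : 0 < σ := Real.sqrt_pos.2 hpos
  have hσ2 : σ ^ 2 = ∫ z, w z ^ 2 ∂Q := Real.sq_sqrt hpos.le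
  -- Chosen so that `r²σ²/2 = t`, which makes the total Chernoff exponent `-N t`.
  set r := √(2 * t) / σ with hr
  have hr0 : 0 ≤ r := by positivity
  have hrσ : r * σ = √(2 * t) := by rw [hr]; field_simp
  have hexpi : Integrable (fun z => Real.exp (-(r * w z))) Q := by
    refine Integrable.mono' (integrable_const 1) (by fun_prop) (ae_of_all _ fun z => ?_)
    rw [Real.norm_eq_abs, Real.abs_exp, Real.exp_le_one_iff]
    have := hw0 z
    nlinarith [mul_nonneg hr0 this.le]
  have hmgf : ∫ z, Real.exp (-(r * w z)) ∂Q ≤ Real.exp (-(r * m) + t) := by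
    have hq : Integrable (fun z => 1 - r * w z + (r * w z) ^ 2 / 2) Q := by
      simp only [mul_pow]
      exact ((integrable_const _).sub (hw1.const_mul r)).add ((hw2.const_mul (r ^ 2)).div_const 2)
    calc ∫ z, Real.exp (-(r * w z)) ∂Q ≤ ∫ z, (1 - r * w z + (r * w z) ^ 2 / 2) ∂Q :=
          integral_mono hexpi hq fun z => exp_neg_le_quadratic (mul_nonneg hr0 (hw0 z).le)
      _ = 1 - r * m + r ^ 2 * σ ^ 2 / 2 := by
          simp only [mul_pow]
          rw [integral_add (by exact (integrable_const _).sub (hw1.const_mul r))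
            ((hw2.const_mul (r ^ 2)).div_const 2), integral_sub (integrable_const _)
            (hw1.const_mul r), integral_div, integral_const_mul, integral_const_mul, hσ2]
          simp [m]
      _ = -(r * m) + t + 1 := by
          rw [← mul_pow, hrσ, Real.sq_sqrt (by positivity)]; ring
      _ ≤ _ := Real.add_one_le_exp _
  set ν := Measure.pi fun _ : Fin N => Q
  have hprod : Integrable (fun D : Fin N → Z => ∏ i, Real.exp (-(r * w (D i)))) ν :=
    Integrable.fintype_prod (f := fun _ z => Real.exp (-(r * w z))) fun _ => hexpi
  have hint : ∫ D, ∏ i, Real.exp (-(r * w (D i))) ∂ν ≤ Real.exp (-(r * m) + t) ^ N := by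
    rw [integral_fintype_prod_eq_pow (ι := Fin N) (fun z => Real.exp (-(r * w z))),
      Fintype.card_fin]
    exact pow_le_pow_left₀ (integral_nonneg fun _ => (Real.exp_pos _).le) hmgf N
  have hmarkov := mul_meas_ge_le_integral_of_nonneg
    (ae_of_all _ fun D => Finset.prod_nonneg fun i _ => (Real.exp_pos _).le) hprod
    (Real.exp (-(r * (N * (m - σ * √(2 * t))))))
  rw [← ofReal_measureReal]
  refine ENNReal.ofReal_le_ofReal ?_
  have hsub : {D : Fin N → Z | ∑ i, w (D i) ≤ N * (m - σ * √(2 * t))} ⊆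
      {D | Real.exp (-(r * (N * (m - σ * √(2 * t))))) ≤ ∏ i, Real.exp (-(r * w (D i)))} := by
    intro D hD
    simp only [Set.mem_ofPred_eq] at hD ⊢
    rw [← Real.exp_sum, Real.exp_le_exp, Finset.sum_neg_distrib, ← Finset.mul_sum]
    exact neg_le_neg (mul_le_mul_of_nonneg_left hD hr0)
  have h1 : ν.real {D : Fin N → Z | ∑ i, w (D i) ≤ N * (m - σ * √(2 * t))} *
      Real.exp (-(r * (N * (m - σ * √(2 * t))))) ≤ Real.exp (-(r * m) + t) ^ N := by
    rw [mul_comm]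
    exact (mul_le_mul_of_nonneg_left (measureReal_mono hsub) (Real.exp_pos _).le).trans
      (hmarkov.trans hint)
  rw [← le_div_iff₀ (Real.exp_pos _), ← Real.exp_nat_mul, ← Real.exp_sub] at h1
  refine h1.trans (Real.exp_le_exp.2 (le_of_eq ?_))
  have : r * (σ * √(2 * t)) = 2 * t := by
    rw [← mul_assoc, hrσ, Real.mul_self_sqrt (by positivity)]
  linear_combination (-(N : ℝ)) * this

/-- With probability at least `1 / 6`, a sample has a mean of `ψ` that is not much too small, and
a second moment of the envelope `w` of `ψ` that is not too large. -/
theorem ghost_sample_bound (Q : Measure Z) [IsProbabilityMeasure Q] {N : ℕ} (hN : 0 < N)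
    {w ψ : Z → ℝ} (hwm : Measurable w) (hw0 : ∀ z, 0 < w z)
    (hw2 : Integrable (fun z => w z ^ 2) Q) (hψm : Measurable ψ) (hψ : ∀ z, |ψ z| ≤ w z) :
    6⁻¹ ≤ (Measure.pi fun _ : Fin N => Q) {D | N * ∫ z, ψ z ∂Q - √(∫ z, w z ^ 2 ∂Q) * √(3 * N)
      ≤ ∑ i, ψ (D i) ∧ ∑ i, w (D i) ^ 2 ≤ 2 * (N * ∫ z, w z ^ 2 ∂Q)} := by
  set ν := Measure.pi fun _ : Fin N => Q with hν
  have hN' : (0 : ℝ) < N := by exact_mod_cast hN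
  have hpos : 0 < ∫ z, w z ^ 2 ∂Q := by
    rw [integral_pos_iff_support_of_nonneg (fun z => sq_nonneg _) hw2]
    have : Function.support (fun z => w z ^ 2) = Set.univ := by
      ext z; simp [(hw0 z).ne']
    simp [this]
  set V := ∫ z, w z ^ 2 ∂Q with hV
  have hwL : MemLp w 2 Q := (memLp_two_iff_integrable_sq hwm.aestronglyMeasurable).2 hw2
  have hψL : MemLp ψ 2 Q := hwL.of_le hψm.aestronglyMeasurable
    (ae_of_all _ fun z => (hψ z).trans (le_abs_self _))
  -- Markov's inequality
  have h1 : ν {D | ¬ ∑ i, w (D i) ^ 2 ≤ 2 * (N * V)} ≤ ENNReal.ofReal (1 / 2) := by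
    have hi : ∀ i : Fin N, Integrable (fun D : Fin N → Z => w (D i) ^ 2) ν := fun i =>
      integrable_comp_eval (μ := fun _ : Fin N => Q) (f := fun z => w z ^ 2) hw2
    have hm := mul_meas_ge_le_integral_of_nonneg (μ := ν)
      (f := fun D => ∑ i, w (D i) ^ 2)
      (ae_of_all _ fun D => Finset.sum_nonneg fun i _ => sq_nonneg _)
      (integrable_finsetSum _ fun i _ => hi i) (2 * (N * V))
    have he : ∫ D, ∑ i, w (D i) ^ 2 ∂ν = N * V := by
      rw [integral_finsetSum _ fun i _ => hi i]
      have : ∀ i : Fin N, ∫ D : Fin N → Z, w (D i) ^ 2 ∂ν = V := fun i =>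
        integral_comp_eval (μ := fun _ : Fin N => Q) (f := fun z => w z ^ 2)
          hw2.aestronglyMeasurable
      simp [this]
    rw [he] at hm
    rw [← ofReal_measureReal]
    refine ENNReal.ofReal_le_ofReal ?_
    have hsub : ν.real {D : Fin N → Z | ¬ ∑ i, w (D i) ^ 2 ≤ 2 * (N * V)} ≤
        ν.real {D | 2 * (N * V) ≤ ∑ i, w (D i) ^ 2} :=
      measureReal_mono fun D (hD : ¬ _) => (not_le.1 hD).le
    have hNV : 0 < N * V := by positivity
    nlinarith
  -- Chebyshev's inequality
  have h2 : ν {D | ¬ N * ∫ z, ψ z ∂Q - √V * √(3 * N) ≤ ∑ i, ψ (D i)} ≤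
      ENNReal.ofReal (1 / 3) := by
    have hL : ∀ i : Fin N, MemLp (fun D : Fin N → Z => ψ (D i)) 2 ν := fun i =>
      hψL.comp_measurePreserving (measurePreserving_eval (fun _ : Fin N => Q) i)
    have hL' : MemLp (∑ i, fun D : Fin N → Z => ψ (D i)) 2 ν := memLp_finsetSum' _ fun i _ => hL i
    have hc : 0 < √V * √(3 * N) := by positivity
    have hcheb := meas_ge_le_variance_div_sq hL' hc
    have hvar : Var[∑ i, fun D : Fin N → Z => ψ (D i); ν] = N * Var[ψ; Q] := by
      rw [hν, variance_sum_pi (μ := fun _ : Fin N => Q) (X := fun _ => ψ) fun _ => hψL]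
      simp
    have hvar' : Var[ψ; Q] ≤ V := by
      refine (variance_le_expectation_sq hψm.aestronglyMeasurable).trans ?_
      refine integral_mono hψL.integrable_sq hw2 fun z => ?_
      exact sq_le_sq' (neg_le_of_abs_le (hψ z)) (le_of_abs_le (hψ z))
    have he : ν[∑ i, fun D : Fin N → Z => ψ (D i)] = N * ∫ z, ψ z ∂Q := by
      simp only [Finset.sum_apply]
      rw [integral_finsetSum _ fun i _ => (hL i).integrable one_le_two]
      have : ∀ i : Fin N, ∫ D : Fin N → Z, ψ (D i) ∂ν = ∫ z, ψ z ∂Q := fun i =>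
        integral_comp_eval (μ := fun _ : Fin N => Q) (f := ψ) hψL.aestronglyMeasurable
      simp [this]
    refine (measure_mono ?_).trans (hcheb.trans (ENNReal.ofReal_le_ofReal ?_))
    · intro D hD
      simp only [Set.mem_ofPred_eq, not_le] at hD ⊢
      rw [he, Finset.sum_apply, abs_sub_comm]
      refine le_trans ?_ (le_abs_self _)
      linarith
    · rw [hvar, mul_pow, Real.sq_sqrt hpos.le, Real.sq_sqrt (by positivity),
        div_le_div_iff₀ (by positivity) (by norm_num)]
      nlinarith
  have hcompl : ν {D | N * ∫ z, ψ z ∂Q - √V * √(3 * N) ≤ ∑ i, ψ (D i) ∧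
      ∑ i, w (D i) ^ 2 ≤ 2 * (N * V)}ᶜ ≤ ENNReal.ofReal (5 / 6) := by
    have hu : {D : Fin N → Z | N * ∫ z, ψ z ∂Q - √V * √(3 * N) ≤ ∑ i, ψ (D i) ∧
      ∑ i, w (D i) ^ 2 ≤ 2 * (N * V)}ᶜ ⊆
      {D | ¬ N * ∫ z, ψ z ∂Q - √V * √(3 * N) ≤ ∑ i, ψ (D i)} ∪
      {D | ¬ ∑ i, w (D i) ^ 2 ≤ 2 * (N * V)} := by
      intro D hD
      simp only [Set.mem_compl_iff, Set.mem_ofPred_eq, not_and_or] at hD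
      exact hD
    refine (measure_mono hu).trans ((measure_union_le _ _).trans ((add_le_add h2 h1).trans ?_))
    rw [← ENNReal.ofReal_add (by norm_num) (by norm_num)]
    exact ENNReal.ofReal_le_ofReal (by norm_num)
  have hone := measure_univ_le_add_compl (μ := ν) {D | N * ∫ z, ψ z ∂Q - √V * √(3 * N)
      ≤ ∑ i, ψ (D i) ∧ ∑ i, w (D i) ^ 2 ≤ 2 * (N * V)}
  rw [measure_univ] at hone
  have hfive : ENNReal.ofReal (5 / 6) ≠ ⊤ := ENNReal.ofReal_ne_top
  have h6 : (1 : ENNReal) = 6⁻¹ + ENNReal.ofReal (5 / 6) := by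
    have : (6⁻¹ : ENNReal) = ENNReal.ofReal (1 / 6) := by
      rw [one_div, ENNReal.ofReal_inv_of_pos (by norm_num)]; norm_num
    rw [this, ← ENNReal.ofReal_add (by norm_num) (by norm_num)]
    norm_num
  have hfin := hone.trans (add_le_add_right hcompl _)
  rw [h6] at hfin
  exact (ENNReal.add_le_add_iff_right hfive).1 hfin

/-- Integrating the section measures of `G` gives at least `μ A / 6`. `A` itself need not be
measurable, since Markov's inequality is applied to the section measure. -/
theorem measure_le_of_ghost {α β : Type*} [MeasurableSpace α] [MeasurableSpace β]
    (μ : Measure α) (ν : Measure β) [SFinite ν] {A : Set α} {G : Set (α × β)}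
    (hG : MeasurableSet G) (h : ∀ a ∈ A, 6⁻¹ ≤ ν (Prod.mk a ⁻¹' G)) :
    μ A ≤ 6 * μ.prod ν G := by
  have h1 := mul_meas_ge_le_lintegral (μ := μ) (measurable_measure_prodMk_left hG (ν := ν)) 6⁻¹
  rw [← Measure.prod_apply hG] at h1
  have h2 : (6⁻¹ : ENNReal) * μ A ≤ μ.prod ν G :=
    (mul_le_mul_right (measure_mono fun a ha => h a ha) _).trans h1
  calc μ A = 6 * (6⁻¹ * μ A) := by
        rw [← mul_assoc, ENNReal.mul_inv_cancel (by norm_num) (by norm_num), one_mul]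
    _ ≤ _ := mul_le_mul_right h2 _

theorem measurePreserving_swapPairs (Q : Measure Z) [IsProbabilityMeasure Q] {N : ℕ}
    (ε : Fin N → Bool) : MeasurePreserving (swapPairs (Z := Z) ε)
      (Measure.pi fun _ : Fin N => Q.prod Q) (Measure.pi fun _ : Fin N => Q.prod Q) := by
  refine measurePreserving_pi (fun _ : Fin N => Q.prod Q) (fun _ : Fin N => Q.prod Q)
    (f := fun i p => if ε i then p.swap else p) fun i => ?_
  by_cases h : ε i
  · simpa [h] using Measure.measurePreserving_swap (μ := Q) (ν := Q)
  · simpa [h] using! MeasurePreserving.id (Q.prod Q)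

open Classical in
/-- The symmetrization principle: an event of which every orbit under exchanges contains a
proportion of at most `c` has probability at most `c`. -/
theorem measure_le_of_card_swaps (Q : Measure Z) [IsProbabilityMeasure Q] {N : ℕ}
    {G : Set (Fin N → Z × Z)} (hG : MeasurableSet G) {c : ℝ}
    (h : ∀ E, ((Finset.univ.filter fun ε : Fin N → Bool => swapPairs ε E ∈ G).card : ℝ) ≤
      2 ^ N * c) : (Measure.pi fun _ : Fin N => Q.prod Q) G ≤ ENNReal.ofReal c := by
  set ν := Measure.pi fun _ : Fin N => Q.prod Q
  have h1 : ∑ ε : Fin N → Bool, ν (swapPairs ε ⁻¹' G) = 2 ^ N * ν G := by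
    have : ∀ ε : Fin N → Bool, ν (swapPairs ε ⁻¹' G) = ν G := fun ε =>
      (measurePreserving_swapPairs Q ε).measure_preimage hG.nullMeasurableSet
    simp [this]
  have h2 : ∑ ε : Fin N → Bool, ν (swapPairs ε ⁻¹' G) ≤ ENNReal.ofReal (2 ^ N * c) := by
    calc ∑ ε : Fin N → Bool, ν (swapPairs ε ⁻¹' G)
        = ∑ ε : Fin N → Bool, ∫⁻ E, (swapPairs ε ⁻¹' G).indicator 1 E ∂ν := by
          refine Finset.sum_congr rfl fun ε _ => (lintegral_indicator_one ?_).symm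
          exact (measurePreserving_swapPairs Q ε).measurable hG
      _ = ∫⁻ E, ∑ ε : Fin N → Bool, (swapPairs ε ⁻¹' G).indicator 1 E ∂ν := by
          rw [lintegral_finsetSum]
          exact fun ε _ => measurable_one.indicator
            ((measurePreserving_swapPairs Q ε).measurable hG)
      _ ≤ ∫⁻ E, ENNReal.ofReal (2 ^ N * c) ∂ν := by
          refine lintegral_mono fun E => ?_
          have : ∑ ε : Fin N → Bool, (swapPairs ε ⁻¹' G).indicator (1 : (Fin N → Z × Z) → ENNReal) E =
              ((Finset.univ.filter fun ε : Fin N → Bool => swapPairs ε E ∈ G).card : ENNReal) := by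
            simp only [Set.indicator_apply, Set.mem_preimage, Pi.one_apply]
            rw [Finset.sum_boole]
          beta_reduce
          rw [this, ← ENNReal.ofReal_natCast]
          exact ENNReal.ofReal_le_ofReal (h E)
      _ = _ := by simp
  rw [h1, ENNReal.ofReal_mul (by positivity)] at h2
  rw [ENNReal.ofReal_pow (by norm_num), ENNReal.ofReal_ofNat] at h2
  exact (ENNReal.mul_le_mul_iff_right (by simp) (by simp)).1 h2

end

/-! ### Deviation of the weighted empirical risk minimizer. -/

section

variable {Z : Type*} [MeasurableSpace Z]

/-- The members of a class of pseudo-dimension zero agree. -/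
theorem eq_of_pseudoDim_le_zero {Z : Type*} {U : Set (Z → ℝ)} (hU : pseudoDim U ≤ (0 : ℕ))
    {u v : Z → ℝ} (hu : u ∈ U) (hv : v ∈ U) : u = v := by
  by_contra hne
  obtain ⟨z, hz⟩ := Function.ne_iff.1 hne
  wlog hlt : u z < v z generalizing u v with H
  · exact H hv hu (Ne.symm hne) hz.symm (lt_of_le_of_ne (not_lt.1 hlt) hz.symm)
  have hs : PseudoShatters U {z} := by
    refine ⟨v, fun A hA => ?_⟩
    rcases Finset.subset_singleton_iff.1 hA with rfl | rfl
    · exact ⟨u, hu, by simpa using hlt⟩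
    · exact ⟨v, hv, by simp⟩
  simpa using card_le_of_pseudoShatters hU hs

/-- The event that the quantized selected function has a large gap on a double sample. -/
def gapEvent {N : ℕ} (w u₀ : Z → ℝ) (û : (Fin N → Z) → Z → ℝ) (K : ℕ) (l : ℝ)
    (T : Set (Fin N → Z)) : Set (Fin N → Z × Z) :=
  {E | (fun i => (E i).1) ∈ T ∧ 2 * √(l * sampleTotal (fun z => w z ^ 2) E) <
    sampleGap (fun z => w z * (quantize K (û fun i => (E i).1) z - u₀ z)) E}

/-- The event involves only the selected function and no supremum over the class, so joint
measurability of the selection suffices. -/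
theorem measurableSet_gapEvent {N : ℕ} {w u₀ : Z → ℝ} (hw : Measurable w) (hu₀ : Measurable u₀)
    {û : (Fin N → Z) → Z → ℝ} (hû : Measurable (Function.uncurry û)) (K : ℕ) (l : ℝ)
    {T : Set (Fin N → Z)} (hT : MeasurableSet T) : MeasurableSet (gapEvent w u₀ û K l T) := by
  have hfst : Measurable fun E : Fin N → Z × Z => fun i => (E i).1 := by fun_prop
  have hq : ∀ g : (Fin N → Z × Z) → Z, Measurable g →
      Measurable fun E : Fin N → Z × Z => quantize K (û fun i => (E i).1) (g E) := by
    intro g hg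
    have h1 : Measurable fun E : Fin N → Z × Z => û (fun i => (E i).1) (g E) :=
      hû.comp (hfst.prodMk hg)
    exact (measurable_from_nat.comp (Nat.measurable_floor.comp (h1.const_mul _))).div_const _
  have hlt : MeasurableSet {E : Fin N → Z × Z | 2 * √(l * sampleTotal (fun z => w z ^ 2) E) <
      sampleGap (fun z => w z * (quantize K (û fun i => (E i).1) z - u₀ z)) E} := by
    refine measurableSet_lt ?_ ?_
    · unfold sampleTotal
      fun_prop
    · unfold sampleGap
      refine Finset.measurable_fun_sum _ fun i _ => ?_
      have h1 := hq (fun E => (E i).1) (by fun_prop)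
      have h2 := hq (fun E => (E i).2) (by fun_prop)
      fun_prop
  exact (hfst hT).inter hlt

/-- An exchange changes the first sample and with it the selected function, so the count on each
orbit has to allow every member of `U`. -/
theorem measure_gapEvent_le (Q : Measure Z) [IsProbabilityMeasure Q] {N : ℕ} (hN : 0 < N)
    {w u₀ : Z → ℝ} (hwm : Measurable w) (hw0 : ∀ z, 0 < w z) (hu₀m : Measurable u₀)
    {U : Set (Z → ℝ)} (hU01 : ∀ u ∈ U, ∀ z, u z ∈ Set.Icc (0 : ℝ) 1) (hu₀ : u₀ ∈ U)
    {d K : ℕ} (hU : pseudoDim U ≤ d) (hd : 0 < d) (hK : 0 < K) (hdN : d ≤ 2 * N)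
    {û : (Fin N → Z) → Z → ℝ} (hûm : Measurable (Function.uncurry û))
    {T : Set (Fin N → Z)} (hT : MeasurableSet T) (hTU : ∀ D ∈ T, û D ∈ U)
    {l : ℝ} (hl : 0 ≤ l) :
    (Measure.pi fun _ : Fin N => Q.prod Q) (gapEvent w u₀ û K l T) ≤
      ENNReal.ofReal ((2 * N * K * Real.exp 1 / d) ^ d * Real.exp (-l)) := by
  classical
  refine measure_le_of_card_swaps Q (measurableSet_gapEvent hwm hu₀m hûm K l hT) fun E => ?_
  refine le_trans ?_ (card_swaps_le hN hw0 hU01 hU hd hK hdN hu₀ hl E)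
  refine Nat.cast_le.2 (Finset.card_le_card fun ε hε => ?_)
  obtain ⟨h1, h2⟩ := (Finset.mem_filter.1 hε).2
  exact Finset.mem_filter.2 ⟨Finset.mem_univ _, _, hTU _ h1, h2⟩

theorem sum_le_mul_of_sum_sq_le {N : ℕ} {a : Fin N → ℝ} {b : ℝ} (hb : 0 ≤ b)
    (h : ∑ i, a i ^ 2 ≤ N * b ^ 2) : ∑ i, a i ≤ N * b := by
  refine le_of_sq_le_sq ?_ (by positivity)
  have := sq_sum_le_card_mul_sum_sq (s := Finset.univ) (f := a)
  rw [Finset.card_univ, Fintype.card_fin] at this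
  calc (∑ i, a i) ^ 2 ≤ N * ∑ i, a i ^ 2 := this
    _ ≤ N * (N * b ^ 2) := by gcongr
    _ = _ := by ring

omit [MeasurableSpace Z] in
/-- If the first sample is bad and the second is typical, then the double sample has a large
gap. -/
theorem mem_gapEvent {N : ℕ} (hN : 0 < N) {w u₀ : Z → ℝ} (hw0 : ∀ z, 0 < w z)
    {û : (Fin N → Z) → Z → ℝ} {K : ℕ} {T : Set (Fin N → Z)} {l C I σ m : ℝ} (hσ : 0 < σ)
    (hC : 0 < C) (hK : 2 / √C ≤ K) (hl0 : 0 ≤ l) (hl : l ≤ 3 / 2 * (N * C)) (hNC : 3 ≤ N * C)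
    (hmσ : m ≤ σ) (hIm : I ≤ m)
    {D D' : Fin N → Z} (hDT : D ∈ T) (h01 : ∀ z, û D z ∈ Set.Icc (0 : ℝ) 1)
    (herm : ∑ i, w (D i) * (û D (D i) - u₀ (D i)) ≤ 0)
    (hlow : N * (m - σ * √(2 * C)) < ∑ i, w (D i))
    (hbad : 2 ^ (5 / 4 : ℝ) * C ^ (3 / 8 : ℝ) *
      (σ + √(empiricalMean D fun z => w z ^ 2)) < I)
    (h1 : N * I - σ * √(3 * N) ≤ ∑ i, w (D' i) * (û D (D' i) - u₀ (D' i)))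
    (h2 : ∑ i, w (D' i) ^ 2 ≤ 2 * (N * σ ^ 2)) :
    (fun i => (D i, D' i)) ∈ gapEvent w u₀ û K l T := by
  have hN' : (0 : ℝ) < N := by exact_mod_cast hN
  have hsC : 0 < √C := Real.sqrt_pos.2 hC
  have hK0 : (0 : ℝ) < K := lt_of_lt_of_le (by positivity) hK
  have hKn : 0 < K := by exact_mod_cast hK0
  refine ⟨hDT, ?_⟩
  set S := √(empiricalMean D fun z => w z ^ 2) with hS
  set τ := 2 ^ (5 / 4 : ℝ) * C ^ (3 / 8 : ℝ) with hτ
  have hS0 : 0 ≤ S := Real.sqrt_nonneg _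
  have hNS : N * S ^ 2 = ∑ i, w (D i) ^ 2 := by
    rw [hS, Real.sq_sqrt]
    · unfold empiricalMean; field_simp
    · exact mul_nonneg (by positivity) (Finset.sum_nonneg fun i _ => sq_nonneg _)
  set s := S / σ with hs
  have hSs : S = s * σ := by rw [hs]; field_simp
  have hs0 : 0 ≤ s := by positivity
  have hbad' : τ * (1 + s) * σ < I := by rw [hSs] at hbad; linarith
  -- The lower tail event bounds the empirical second moment from below, since the mean of the
  -- weights is at most `S` by Cauchy–Schwarz. This supplies the second hypothesis of
  -- `threshold_le`.
  have hSw : m - σ * √(2 * C) < S := by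
    have := hlow.trans_le (sum_le_mul_of_sum_sq_le hS0 hNS.ge)
    exact lt_of_mul_lt_mul_left this hN'.le
  have t1 : τ * (1 + s) < 1 := by
    refine lt_of_mul_lt_mul_right ?_ hσ.le
    linarith
  have t2 : τ * (1 + s) < s + √(2 * C) := by
    refine lt_of_mul_lt_mul_right ?_ hσ.le
    rw [hSs] at hSw
    linarith
  have key := threshold_le hC hs0 t1 t2
  -- the gap is large
  have hgap : N * I - σ * √(3 * N) - N * (√2 * σ) / K ≤
      sampleGap (fun z => w z * (quantize K (û D) z - u₀ z)) fun i => (D i, D' i) := by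
    have e1 : ∑ i, w (D' i) ≤ N * (√2 * σ) := by
      refine sum_le_mul_of_sum_sq_le (by positivity) (h2.trans (le_of_eq ?_))
      rw [mul_pow, Real.sq_sqrt (by norm_num)]; ring
    have e2 : ∑ i, w (D' i) * (û D (D' i) - u₀ (D' i)) - (∑ i, w (D' i)) / K ≤
        ∑ i, w (D' i) * (quantize K (û D) (D' i) - u₀ (D' i)) := by
      rw [Finset.sum_div, ← Finset.sum_sub_distrib]
      refine Finset.sum_le_sum fun i _ => ?_
      have := mul_le_mul_of_nonneg_left (le_quantize_add hKn (û D) (D' i)) (hw0 (D' i)).le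
      rw [mul_add, mul_one_div] at this
      linarith
    have e3 : ∑ i, w (D i) * (quantize K (û D) (D i) - u₀ (D i)) ≤ 0 := by
      refine (Finset.sum_le_sum fun i _ => ?_).trans herm
      exact mul_le_mul_of_nonneg_left
        (sub_le_sub_right (quantize_le hKn (h01 _).1) _) (hw0 _).le
    have e4 : (∑ i, w (D' i)) / K ≤ N * (√2 * σ) / K := by gcongr
    simp only [sampleGap, Finset.sum_sub_distrib]
    linarith
  have htot : sampleTotal (fun z => w z ^ 2) (fun i => (D i, D' i)) ≤
      N * σ ^ 2 * (s ^ 2 + 2) := by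
    simp only [sampleTotal, Finset.sum_add_distrib]
    rw [← hNS, hSs]
    linarith
  have hsqrt : √(l * sampleTotal (fun z => w z ^ 2) fun i => (D i, D' i)) ≤
      N * σ * (√C * (√(3 / 2) * √(s ^ 2 + 2))) := by
    calc √(l * sampleTotal (fun z => w z ^ 2) fun i => (D i, D' i))
        ≤ √(3 / 2 * (N * C) * (N * σ ^ 2 * (s ^ 2 + 2))) := by
          refine Real.sqrt_le_sqrt ((mul_le_mul_of_nonneg_left htot hl0).trans ?_)
          gcongr
      _ = √((N * σ) ^ 2 * (C * (3 / 2 * (s ^ 2 + 2)))) := by congr 1; ring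
      _ = _ := by
          rw [Real.sqrt_mul (by positivity), Real.sqrt_sq (by positivity),
            Real.sqrt_mul hC.le, Real.sqrt_mul (by norm_num)]
  have h3N : √(3 * N) ≤ N * √C := by
    rw [Real.sqrt_le_left (by positivity), mul_pow, Real.sq_sqrt hC.le]
    nlinarith
  have hKinv : 1 / (K : ℝ) ≤ √C / 2 := by
    rw [div_le_iff₀ hsC] at hK
    rw [div_le_iff₀ hK0]
    linarith
  -- The summands `1`, `√2/2` and `2√(3/2)√(s² + 2)` of `threshold_le` pay for the Chebyshev loss,
  -- the rounding and the gap threshold, respectively.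
  refine lt_of_lt_of_le ?_ hgap
  have f1 : N * (τ * (1 + s) * σ) < N * I := by gcongr
  have f2 : N * σ * (√C * (1 + √2 / 2 + 2 * √(3 / 2) * √(s ^ 2 + 2))) ≤
      N * σ * (τ * (1 + s)) := by gcongr
  have f3 : σ * √(3 * N) ≤ σ * (N * √C) := by gcongr
  have f4 : N * (√2 * σ) / K ≤ N * (√2 * σ) * (√C / 2) := by
    rw [div_eq_mul_one_div]; gcongr
  linarith

theorem two_le_log_four_div {δ : ℝ} (hδ : 0 < δ) (hδ2 : δ < 1 / 2) : 2 ≤ Real.log (4 / δ) := by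
  rw [Real.le_log_iff_exp_le (by positivity), le_div_iff₀ hδ]
  have h := Real.exp_one_lt_d9
  have h2 : Real.exp 2 = Real.exp 1 * Real.exp 1 := by rw [← Real.exp_add]; norm_num
  nlinarith [Real.exp_pos 1, Real.exp_pos 2]

theorem complexityTerm_pos {d N : ℕ} (hN : 0 < N) (hdN : d ≤ 2 * N) {δ : ℝ} (hδ : 0 < δ)
    (hδ2 : δ < 1 / 2) : 0 < complexityTerm d N δ := by
  have hN' : (0 : ℝ) < N := by exact_mod_cast hN
  have hlog := two_le_log_four_div hδ hδ2
  refine div_pos (add_pos_of_nonneg_of_pos ?_ (by linarith)) hN'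
  rcases Nat.eq_zero_or_pos d with rfl | hd
  · simp
  · have hd' : (0 : ℝ) < d := by exact_mod_cast hd
    refine mul_nonneg hd'.le (Real.log_nonneg ((one_le_div hd').2 ?_))
    have h1 : (d : ℝ) ≤ 2 * N := by exact_mod_cast hdN
    nlinarith [Real.add_one_le_exp 1]

/-- Uniform deviation bound for weighted empirical risk minimization over a class of functions
with values in `[0, 1]`, with unbounded weights that have a second moment. -/
theorem weighted_erm_deviation (Q : Measure Z) [IsProbabilityMeasure Q] {w : Z → ℝ}
    (hwm : Measurable w) (hw0 : ∀ z, 0 < w z) (hw2 : Integrable (fun z => w z ^ 2) Q)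
    {U : Set (Z → ℝ)} (hUm : ∀ u ∈ U, Measurable u)
    (hU01 : ∀ u ∈ U, ∀ z, u z ∈ Set.Icc (0 : ℝ) 1) {d : ℕ} (hU : pseudoDim U ≤ d)
    {N : ℕ} (hN : 0 < N) (hdN : d ≤ 2 * N) {u₀ : Z → ℝ} (hu₀ : u₀ ∈ U)
    {û : (Fin N → Z) → Z → ℝ} (hûm : Measurable (Function.uncurry û))
    (hû : ∀ᵐ D ∂(Measure.pi fun _ : Fin N => Q), û D ∈ U ∧
      ∑ i, w (D i) * (û D (D i) - u₀ (D i)) ≤ 0) {δ : ℝ} (hδ : 0 < δ) :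
    (Measure.pi fun _ : Fin N => Q)
      {D | 2 ^ (5 / 4 : ℝ) * complexityTerm d N δ ^ (3 / 8 : ℝ) * momentTerm Q w D <
        ∫ z, w z * (û D z - u₀ z) ∂Q} ≤ ENNReal.ofReal (2 * δ) := by
  set ν := Measure.pi fun _ : Fin N => Q with hν
  rcases le_or_gt (1 / 2) δ with hδ2 | hδ2
  · refine prob_le_one.trans ?_
    rw [← ENNReal.ofReal_one]
    exact ENNReal.ofReal_le_ofReal (by linarith)
  have hN' : (0 : ℝ) < N := by exact_mod_cast hN
  set C := complexityTerm d N δ with hCdef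
  have hlog : 2 ≤ Real.log (4 / δ) := two_le_log_four_div hδ hδ2
  have hNC' : N * C = d * Real.log (2 * N * Real.exp 1 / d) + Real.log (4 / δ) := by
    rw [hCdef, complexityTerm]; field_simp
  have hpos : 0 < ∫ z, w z ^ 2 ∂Q := by
    rw [integral_pos_iff_support_of_nonneg (fun z => sq_nonneg _) hw2]
    have : Function.support (fun z => w z ^ 2) = Set.univ := by
      ext z; simp [(hw0 z).ne']
    simp [this]
  set σ := √(∫ z, w z ^ 2 ∂Q) with hσ
  have hσ0 : 0 < σ := Real.sqrt_pos.2 hpos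
  have hσ2 : σ ^ 2 = ∫ z, w z ^ 2 ∂Q := Real.sq_sqrt hpos.le
  have hwL : MemLp w 2 Q := (memLp_two_iff_integrable_sq hwm.aestronglyMeasurable).2 hw2
  have hw1 : Integrable w Q := hwL.integrable one_le_two
  have hmσ : ∫ z, w z ∂Q ≤ σ := by
    refine Real.le_sqrt_of_sq_le ?_
    have := variance_nonneg w Q
    rw [variance_eq_sub hwL] at this
    simpa using this
  have hψ : ∀ u ∈ U, ∀ z, |w z * (u z - u₀ z)| ≤ w z := by
    intro u hu z
    rw [abs_mul, abs_of_pos (hw0 z)]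
    exact mul_le_of_le_one_right (hw0 z).le (abs_le.2
      ⟨by linarith [(hU01 u hu z).1, (hU01 u₀ hu₀ z).2],
        by linarith [(hU01 u hu z).2, (hU01 u₀ hu₀ z).1]⟩)
  have hIm : ∀ u ∈ U, ∫ z, w z * (u z - u₀ z) ∂Q ≤ ∫ z, w z ∂Q := by
    intro u hu
    refine integral_mono (hw1.mono' ?_ (ae_of_all _ (hψ u hu))) hw1
      fun z => (le_abs_self _).trans (hψ u hu z)
    exact (hwm.mul ((hUm u hu).sub (hUm u₀ hu₀))).aestronglyMeasurable
  -- The minimizing property holds only almost surely; a measurable set of full measure keeps the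
  -- gap event measurable.
  obtain ⟨T, hTae, hTm, hT⟩ := hû.exists_measurable_mem
  have hTc : ν Tᶜ = 0 := hTae
  have hC : 0 < C := complexityTerm_pos hN hdN hδ hδ2
  set τ := 2 ^ (5 / 4 : ℝ) * C ^ (3 / 8 : ℝ) with hτ
  have hτ0 : 0 ≤ τ := by positivity
  have hM : ∀ D : Fin N → Z, σ ≤ momentTerm Q w D := fun D =>
    le_add_of_nonneg_right (Real.sqrt_nonneg _)
  rcases Nat.eq_zero_or_pos d with rfl | hd
  · refine (measure_mono_null (fun D hD hDT => ?_) hTc).le.trans zero_le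
    have h1 : û D = u₀ := eq_of_pseudoDim_le_zero hU (hT D hDT).1 hu₀
    have h2 : τ * momentTerm Q w D < 0 := by simpa [h1] using hD
    exact h2.not_ge (mul_nonneg hτ0 (hσ0.le.trans (hM D)))
  -- For `τ ≥ 1` the bound is trivial, because the excess is at most `E w ≤ σ ≤ M`.
  rcases le_or_gt 1 τ with hτ1 | hτ1
  · refine (measure_mono_null (fun D hD hDT => ?_) hTc).le.trans zero_le
    have h1 : τ * momentTerm Q w D < ∫ z, w z * (û D z - u₀ z) ∂Q := hD
    have h2 := hIm _ (hT D hDT).1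
    nlinarith [hM D]
  have hd' : (0 : ℝ) < d := by exact_mod_cast hd
  have hd1 : (1 : ℝ) ≤ d := by exact_mod_cast hd
  have hdN' : (d : ℝ) ≤ 2 * N := by exact_mod_cast hdN
  set x := 2 * N * Real.exp 1 / d with hx
  have hx0 : 0 < x := by positivity
  have hlogx : 1 ≤ Real.log x := by
    rw [Real.le_log_iff_exp_le hx0, hx, le_div_iff₀ hd', mul_comm]
    gcongr
  have hNC3 : 3 ≤ N * C := by rw [hNC']; nlinarith
  have hCsmall : √C ≤ 0.3151 := by
    have h1 : (2.378 : ℝ) ≤ 2 ^ (5 / 4 : ℝ) := by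
      refine le_of_pow_le_pow_left₀ (n := 4) (by norm_num) (by positivity) ?_
      rw [← Real.rpow_natCast, ← Real.rpow_natCast, ← Real.rpow_mul (by norm_num)]
      norm_num
    have h3 : C ^ (3 / 8 : ℝ) = (C ^ (1 / 8 : ℝ)) ^ 3 := by
      rw [← Real.rpow_natCast, ← Real.rpow_mul hC.le]; norm_num
    have h4 : √C = (C ^ (1 / 8 : ℝ)) ^ 4 := by
      rw [← Real.rpow_natCast, ← Real.rpow_mul hC.le, Real.sqrt_eq_rpow]; norm_num
    have h5 : C ^ (1 / 8 : ℝ) ≤ 0.7492 := by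
      by_contra! hc
      have h6 : (0.7492 : ℝ) ^ 3 < (C ^ (1 / 8 : ℝ)) ^ 3 := by gcongr
      rw [← h3] at h6
      have h7 : 2.378 * (0.7492 : ℝ) ^ 3 ≤ τ := by rw [hτ]; gcongr
      norm_num at h7
      linarith
    rw [h4]
    calc (C ^ (1 / 8 : ℝ)) ^ 4 ≤ 0.7492 ^ 4 := by gcongr
      _ ≤ _ := by norm_num
  have hsC : 0 < √C := Real.sqrt_pos.2 hC
  -- Fine enough for a rounding error of order `√C`, yet coarse enough that `K² ≤ 2Ne/d`, so
  -- quantizing costs at most half of `N C` in the exponent.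
  set K := ⌈2 / √C⌉₊ with hK
  have hK0 : 0 < K := Nat.ceil_pos.2 (by positivity)
  have hK0' : (0 : ℝ) < K := by exact_mod_cast hK0
  have hK1 : 2 / √C ≤ K := Nat.le_ceil _
  have hK2 : K * √C ≤ 2.3151 := by
    have h1 := (Nat.ceil_lt_add_one (show 0 ≤ 2 / √C by positivity)).le
    calc K * √C ≤ (2 / √C + 1) * √C := by gcongr
      _ = 2 + √C := by field_simp
      _ ≤ _ := by linarith
  have hK3 : (K : ℝ) ^ 2 ≤ x := by
    have h1 : (K : ℝ) ^ 2 * C ≤ 5.37 := by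
      have : (K * √C) ^ 2 ≤ 2.3151 ^ 2 := by gcongr
      rw [mul_pow, Real.sq_sqrt hC.le] at this
      linarith
    have h2 : (d : ℝ) ≤ N * C := by rw [hNC']; nlinarith
    rw [hx, le_div_iff₀ hd']
    have h3 := Real.exp_one_gt_d9
    calc (K : ℝ) ^ 2 * d ≤ K ^ 2 * (N * C) := by gcongr
      _ = N * (K ^ 2 * C) := by ring
      _ ≤ N * (2 * Real.exp 1) := mul_le_mul_of_nonneg_left (by linarith) hN'.le
      _ = _ := by ring
  have hlogK : 2 * Real.log K ≤ Real.log x := by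
    have := Real.log_le_log (by positivity) hK3
    rwa [Real.log_pow, Nat.cast_ofNat] at this
  have hlogK0 : 0 ≤ Real.log K := Real.log_natCast_nonneg K
  -- The term `d log K` cancels the factor `K^d` of the pattern count, leaving exactly `δ/4`.
  set l := N * C + d * Real.log K with hl
  have hl0 : 0 ≤ l := by positivity
  have hl1 : l ≤ 3 / 2 * (N * C) := by
    have : d * (2 * Real.log K) ≤ d * Real.log x := by gcongr
    linarith
  have hprob : (2 * N * K * Real.exp 1 / d) ^ d * Real.exp (-l) = δ / 4 := by
    have h1 : 2 * N * K * Real.exp 1 / d = Real.exp (Real.log x + Real.log K) := by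
      rw [Real.exp_add, Real.exp_log hx0, Real.exp_log hK0', hx]; ring
    have h2 : δ / 4 = Real.exp (-Real.log (4 / δ)) := by
      rw [Real.exp_neg, Real.exp_log (by positivity), inv_div]
    rw [h1, ← Real.exp_nat_mul, ← Real.exp_add, h2, hl, hNC']
    congr 1
    ring
  have hlow := measure_sum_le_exp Q (N := N) hwm hw0 hw2 hC.le
  have hlowδ : Real.exp (-(N * C)) ≤ δ / 4 := by
    have h2 : δ / 4 = Real.exp (-Real.log (4 / δ)) := by
      rw [Real.exp_neg, Real.exp_log (by positivity), inv_div]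
    rw [h2, Real.exp_le_exp, hNC']
    have : 0 ≤ d * Real.log x := by positivity
    linarith
  set low := {D : Fin N → Z | ∑ i, w (D i) ≤ N * (∫ z, w z ∂Q - σ * √(2 * C))}
  set A := {D : Fin N → Z | D ∈ T ∧ D ∉ low ∧
    τ * momentTerm Q w D < ∫ z, w z * (û D z - u₀ z) ∂Q}
  have hA : ν A ≤ 6 * ENNReal.ofReal (δ / 4) := by
    have hpres := measurePreserving_arrowProdEquivProdArrow Z Z (Fin N) (fun _ => Q) fun _ => Q
    have hGm := measurableSet_gapEvent hwm (hUm u₀ hu₀) hûm K l hTm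
    have h1 := hpres.symm.measure_preimage hGm.nullMeasurableSet
    have h2 := measure_gapEvent_le Q hN hwm hw0 (hUm u₀ hu₀) hU01 hu₀ hU hd hK0 hdN hûm hTm
      (fun D hD => (hT D hD).1) hl0
    rw [hprob] at h2
    refine (measure_le_of_ghost ν ν (hpres.symm.measurable hGm) fun D hD => ?_).trans
      (mul_le_mul_right (h1.le.trans h2) _)
    obtain ⟨hDT, hDlow, hDbad⟩ := hD
    have hu := (hT D hDT).1
    refine (ghost_sample_bound Q hN hwm hw0 hw2
      (ψ := fun z => w z * (û D z - u₀ z)) (hwm.mul ((hUm _ hu).sub (hUm u₀ hu₀)))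
      (hψ _ hu)).trans (measure_mono fun D' hD' => ?_)
    exact mem_gapEvent hN hw0 hσ0 hC hK1 hl0 hl1 hNC3 hmσ (hIm _ hu) hDT (hU01 _ hu)
      (hT D hDT).2 (not_le.1 hDlow) hDbad hD'.1 (hσ2 ▸ hD'.2)
  calc _ ≤ ν (Tᶜ ∪ (low ∪ A)) := by
        refine measure_mono fun D hD => ?_
        by_cases h1 : D ∈ T
        · by_cases h2 : D ∈ low
          · exact Or.inr (Or.inl h2)
          · exact Or.inr (Or.inr ⟨h1, h2, hD⟩)
        · exact Or.inl h1
    _ ≤ ν Tᶜ + (ν low + ν A) :=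
        (measure_union_le _ _).trans (add_le_add_right (measure_union_le _ _) _)
    _ ≤ 0 + (ENNReal.ofReal (δ / 4) + 6 * ENNReal.ofReal (δ / 4)) :=
        add_le_add hTc.le (add_le_add (hlow.trans (ENNReal.ofReal_le_ofReal hlowδ)) hA)
    -- One `δ/4` for the lower tail of the weights and six for the ghost sample.
    _ = ENNReal.ofReal (7 * (δ / 4)) := by
        rw [ENNReal.ofReal_mul (by norm_num), ENNReal.ofReal_ofNat]; ring
    _ ≤ _ := ENNReal.ofReal_le_ofReal (by linarith)

end

/-! ### From excess weighted risk to distance from the regression function. -/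

section

/-- The squared loss, rescaled to and truncated at `1`. -/
noncomputable def clippedLoss {X : Type*} (F : ℝ) (f : X → ℝ) (z : X × ℝ) : ℝ :=
  min (squaredLoss f z / (4 * F ^ 2)) 1

theorem clippedLoss_mem_Icc {X : Type*} (F : ℝ) (f : X → ℝ) (z : X × ℝ) :
    clippedLoss F f z ∈ Set.Icc (0 : ℝ) 1 :=
  ⟨le_min (div_nonneg (sq_nonneg _) (by positivity)) zero_le_one, min_le_right _ _⟩

/-- Truncation is inactive where `|y| ≤ F`, as then `|f - y| ≤ 2F`. It serves to have values in `[0,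
1]` everywhere, although `Y` is bounded only almost surely. -/
theorem squaredLoss_eq_mul_clippedLoss {X : Type*} {F : ℝ} (hF : 0 < F) {f : X → ℝ}
    (hf : ∀ x, |f x| ≤ F) {z : X × ℝ} (hz : |z.2| ≤ F) :
    squaredLoss f z = 4 * F ^ 2 * clippedLoss F f z := by
  have h : squaredLoss f z ≤ 4 * F ^ 2 := by
    have h1 : |f z.1 - z.2| ≤ 2 * F := (abs_sub _ _).trans (by linarith [hf z.1])
    calc |f z.1 - z.2| ^ 2 ≤ (2 * F) ^ 2 := by gcongr
      _ = _ := by ring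
  rw [clippedLoss, min_eq_left ((div_le_one (by positivity)).2 h)]
  field_simp

theorem pseudoDim_clippedLoss_le {X : Type*} {F : ℝ} (hF : 0 < F) (H : Set (X → ℝ)) :
    pseudoDim (clippedLoss F '' H) ≤ pseudoDim (squaredLoss '' H) := by
  refine iSup₂_le fun s hs => ?_
  refine le_iSup₂ (f := fun (s : Finset (X × ℝ)) (_ : PseudoShatters (squaredLoss '' H) s) =>
    (s.card : ℕ∞)) s ?_
  obtain ⟨t, ht⟩ := hs
  -- Realizing the full pattern `A = s` forces every threshold to be at most `1`, and such
  -- thresholds do not see the truncation.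
  have ht1 : ∀ z ∈ s, t z ≤ 1 := by
    obtain ⟨_, ⟨f, -, rfl⟩, hf⟩ := ht s subset_rfl
    exact fun z hz => ((hf z hz).2 hz).trans (min_le_right _ _)
  refine ⟨fun z => t z * (4 * F ^ 2), fun A hA => ?_⟩
  obtain ⟨_, ⟨f, hf, rfl⟩, h⟩ := ht A hA
  refine ⟨_, ⟨f, hf, rfl⟩, fun z hz => ?_⟩
  rw [← h z hz, ← le_div_iff₀ (by positivity), clippedLoss, le_min_iff]
  exact ⟨fun h => ⟨h, ht1 z hz⟩, fun h => h.1⟩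

variable {X : Type*} [MeasurableSpace X]

theorem measurable_clippedLoss (F : ℝ) {f : X → ℝ} (hf : Measurable f) :
    Measurable (clippedLoss F f) := by
  unfold clippedLoss squaredLoss
  simp only [sq_abs]
  fun_prop

/-- The unnormalized weighted regression function `x ↦ E_q[v (x, Y) Y | x]`. -/
noncomputable def weightedRegression (q : Kernel X ℝ) (v : X × ℝ → ℝ) (x : X) : ℝ :=
  ∫ y, v (x, y) * y ∂(q x)

theorem measurable_weightedRegression (q : Kernel X ℝ) [IsMarkovKernel q] {v : X × ℝ → ℝ}
    (hv : Measurable v) : Measurable (weightedRegression q v) :=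
  (StronglyMeasurable.integral_kernel_prod_right' (κ := q) (f := fun z : X × ℝ => v z * z.2)
    (hv.mul measurable_snd).stronglyMeasurable).measurable

theorem measurable_regressionFunction (p : Kernel X ℝ) [IsMarkovKernel p] :
    Measurable (regressionFunction p) :=
  (StronglyMeasurable.integral_kernel_prod_right' (κ := p) (f := fun z : X × ℝ => z.2)
    measurable_snd.stronglyMeasurable).measurable

/-- Conditionally on `x`, `|E_q[w Y | x]|² ≤ F² E_q[w | x]² ≤ F² E_q[w² | x]`. -/
theorem memLp_weightedRegression {μ : Measure X} [IsProbabilityMeasure μ] {q : Kernel X ℝ}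
    [IsMarkovKernel q] {F : ℝ} (hF : 0 < F) (hY : ∀ᵐ z ∂(jointLaw μ q), |z.2| ≤ F)
    {w : X × ℝ → ℝ} (hwm : Measurable w) (hw0 : ∀ z, 0 < w z)
    (hw2 : Integrable (fun z => w z ^ 2) (jointLaw μ q)) :
    MemLp (weightedRegression q w) 2 μ := by
  have hm := measurable_weightedRegression q hwm
  rw [memLp_two_iff_integrable_sq hm.aestronglyMeasurable]
  have h2 := (Measure.integrable_compProd_iff hw2.aestronglyMeasurable).1 hw2
  refine (h2.2.const_mul (F ^ 2)).mono' (hm.pow_const 2).aestronglyMeasurable ?_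
  filter_upwards [h2.1, Measure.ae_ae_of_ae_compProd hY] with x hx hYx
  have hwx : Measurable fun y => w (x, y) := hwm.comp measurable_prodMk_left
  have hL : MemLp (fun y => w (x, y)) 2 (q x) :=
    (memLp_two_iff_integrable_sq hwx.aestronglyMeasurable).2 hx
  have h1 : |weightedRegression q w x| ≤ ∫ y, w (x, y) * F ∂(q x) := by
    refine norm_integral_le_of_norm_le (f := fun y => w (x, y) * y)
      ((hL.integrable one_le_two).mul_const F) ?_
    filter_upwards [hYx] with y hy
    rw [norm_mul, Real.norm_of_nonneg (hw0 _).le]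
    exact mul_le_mul_of_nonneg_left hy (hw0 _).le
  have h3 : (∫ y, w (x, y) ∂(q x)) ^ 2 ≤ ∫ y, w (x, y) ^ 2 ∂(q x) := by
    have := variance_nonneg (fun y => w (x, y)) (q x)
    rw [variance_eq_sub hL] at this
    simpa using this
  rw [integral_mul_const] at h1
  simp only [Real.norm_eq_abs, abs_pow, sq_abs]
  rw [← sq_abs]
  calc |weightedRegression q w x| ^ 2 ≤ ((∫ y, w (x, y) ∂(q x)) * F) ^ 2 := by gcongr
    _ = F ^ 2 * (∫ y, w (x, y) ∂(q x)) ^ 2 := by ring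
    _ ≤ _ := by gcongr

theorem integrable_weightBias {μ : Measure X} [IsProbabilityMeasure μ] {q : Kernel X ℝ}
    [IsMarkovKernel q] {w : X × ℝ → ℝ} (hw0 : ∀ z, 0 < w z)
    (hw1 : Integrable w (jointLaw μ q)) : Integrable (weightBias q w) μ := by
  have h := ((Measure.integrable_compProd_iff hw1.aestronglyMeasurable).1 hw1).2
  simp only [Real.norm_of_nonneg (hw0 _).le] at h
  exact h.sub (integrable_const 1)

/-- The excess weighted risk controls the distance to the weighted regression function. -/
theorem integral_sq_sub_weightedRegression_le {μ : Measure X} [IsProbabilityMeasure μ]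
    {q : Kernel X ℝ} [IsMarkovKernel q] {F : ℝ} (hF : 0 < F)
    (hY : ∀ᵐ z ∂(jointLaw μ q), |z.2| ≤ F)
    {w : X × ℝ → ℝ} (hwm : Measurable w) (hw0 : ∀ z, 0 < w z)
    (hw2 : Integrable (fun z => w z ^ 2) (jointLaw μ q)) {f h : X → ℝ}
    (hf : f ∈ boundedMeasurable X F) (hh : h ∈ boundedMeasurable X F) :
    ∫ x, (h x - weightedRegression q w x) ^ 2 ∂μ ≤
      ∫ x, (f x - weightedRegression q w x) ^ 2 ∂μ + F ^ 2 * ∫ x, |weightBias q w x| ∂μ +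
        4 * F ^ 2 * ∫ z, w z * (clippedLoss F h z - clippedLoss F f z) ∂(jointLaw μ q) := by
  have hw1 : Integrable w (jointLaw μ q) :=
    ((memLp_two_iff_integrable_sq hwm.aestronglyMeasurable).2 hw2).integrable one_le_two
  set r := weightedRegression q w with hr
  set g := weightBias q w with hg
  have hgi : Integrable g μ := integrable_weightBias hw0 hw1
  have hrL : MemLp r 2 μ := memLp_weightedRegression hF hY hwm hw0 hw2
  have hbL : ∀ u ∈ boundedMeasurable X F, MemLp u 2 μ := fun u hu =>
    MemLp.of_bound hu.1.aestronglyMeasurable F (ae_of_all _ hu.2)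
  have hhi : Integrable (fun x => (h x - r x) ^ 2) μ := ((hbL h hh).sub hrL).integrable_sq
  have hfi : Integrable (fun x => (f x - r x) ^ 2) μ := ((hbL f hf).sub hrL).integrable_sq
  have hsq : ∀ u ∈ boundedMeasurable X F, ∀ x, u x ^ 2 ≤ F ^ 2 := fun u hu x =>
    sq_le_sq' (neg_le_of_abs_le (hu.2 x)) (le_of_abs_le (hu.2 x))
  have hdiff : ∀ x, |(h x ^ 2 - f x ^ 2) * g x| ≤ F ^ 2 * |g x| := by
    intro x
    rw [abs_mul]
    gcongr
    rw [abs_le]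
    constructor <;> nlinarith [hsq f hf x, hsq h hh x, sq_nonneg (f x), sq_nonneg (h x)]
  have hgsq : Integrable (fun x => (h x ^ 2 - f x ^ 2) * g x) μ :=
    (hgi.abs.const_mul (F ^ 2)).mono' ((((hh.1.pow_const 2).sub
      (hf.1.pow_const 2)).aestronglyMeasurable).mul hgi.aestronglyMeasurable)
      (ae_of_all _ hdiff)
  have hci : Integrable (fun z => 4 * F ^ 2 * (w z * (clippedLoss F h z - clippedLoss F f z)))
      (jointLaw μ q) := by
    refine (hw1.mono' (hwm.mul ((measurable_clippedLoss F hh.1).sub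
      (measurable_clippedLoss F hf.1))).aestronglyMeasurable
      (ae_of_all _ fun z => ?_)).const_mul _
    rw [Pi.mul_apply, Pi.sub_apply, norm_mul, Real.norm_of_nonneg (hw0 z).le]
    refine mul_le_of_le_one_right (hw0 z).le (abs_le.2 ⟨?_, ?_⟩) <;>
      linarith [(clippedLoss_mem_Icc F h z).1, (clippedLoss_mem_Icc F h z).2,
        (clippedLoss_mem_Icc F f z).1, (clippedLoss_mem_Icc F f z).2]
  have hcongr : (fun z => 4 * F ^ 2 * (w z * (clippedLoss F h z - clippedLoss F f z)))
      =ᵐ[jointLaw μ q] fun z => (h z.1 ^ 2 - f z.1 ^ 2) * w z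
        - 2 * (h z.1 - f z.1) * (w z * z.2) := by
    filter_upwards [hY] with z hz
    have e1 := squaredLoss_eq_mul_clippedLoss hF hh.2 hz
    have e2 := squaredLoss_eq_mul_clippedLoss hF hf.2 hz
    simp only [squaredLoss, sq_abs] at e1 e2
    linear_combination w z * (e2 - e1)
  -- Conditionally on `x`, the weighted risk difference is `(h² - f²)(1 + g) - 2(h - f) r`;
  -- completing squares gives the integrand.
  have hid : 4 * F ^ 2 * ∫ z, w z * (clippedLoss F h z - clippedLoss F f z) ∂(jointLaw μ q) =
      ∫ x, ((h x - r x) ^ 2 - (f x - r x) ^ 2 + (h x ^ 2 - f x ^ 2) * g x) ∂μ := by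
    rw [← integral_const_mul, integral_congr_ae hcongr,
      Measure.integral_compProd (hci.congr hcongr)]
    refine integral_congr_ae ?_
    filter_upwards [((Measure.integrable_compProd_iff hw1.aestronglyMeasurable).1 hw1).1,
      Measure.ae_ae_of_ae_compProd hY] with x hx hYx
    have hxy : Integrable (fun y => w (x, y) * y) (q x) := by
      refine (hx.norm.mul_const F).mono' (hx.aestronglyMeasurable.mul
        measurable_id.aestronglyMeasurable) ?_
      filter_upwards [hYx] with y hy
      rw [norm_mul]
      exact mul_le_mul_of_nonneg_left hy (norm_nonneg _)
    rw [integral_sub (hx.const_mul _) (hxy.const_mul _), integral_const_mul, integral_const_mul,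
      hr, hg, weightedRegression, weightBias]
    ring
  have hsub : Integrable (fun x => (h x - r x) ^ 2 - (f x - r x) ^ 2) μ := hhi.sub hfi
  rw [hid, integral_add hsub hgsq, integral_sub hhi hfi]
  have hlow : -(F ^ 2 * ∫ x, |g x| ∂μ) ≤ ∫ x, (h x ^ 2 - f x ^ 2) * g x ∂μ := by
    refine neg_le_of_abs_le ?_
    rw [← integral_const_mul]
    exact norm_integral_le_of_norm_le (f := fun x => (h x ^ 2 - f x ^ 2) * g x)
      (hgi.abs.const_mul _) (ae_of_all _ hdiff)
  linarith

theorem eLpNorm_two_eq_ofReal_sqrt {μ : Measure X} {u : X → ℝ} (hu : MemLp u 2 μ) :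
    eLpNorm u 2 μ = ENNReal.ofReal √(∫ x, u x ^ 2 ∂μ) := by
  rw [hu.eLpNorm_eq_integral_rpow_norm two_ne_zero ENNReal.ofNat_ne_top, Real.sqrt_eq_rpow]
  simp

theorem eLpNorm_two_rpow_two {Ω : Type*} [MeasurableSpace Ω] (ν : Measure Ω) (u : Ω → ℝ) :
    eLpNorm u 2 ν ^ (2 : ℝ) = ∫⁻ ω, ‖u ω‖ₑ ^ (2 : ℝ) ∂ν :=
  eLpNorm_nnreal_pow_eq_lintegral (p := 2) (by norm_num)

/-- The weighted regression function is close to the regression function of the target. -/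
theorem eLpNorm_weightedRegression_sub_le {μ : Measure X} [IsProbabilityMeasure μ]
    {p q : Kernel X ℝ} [IsMarkovKernel p] [IsMarkovKernel q] (hpq : ∀ᵐ x ∂μ, p x ≪ q x) {F : ℝ}
    (hY : ∀ᵐ z ∂(jointLaw μ q), |z.2| ≤ F) {w : X × ℝ → ℝ} (hwm : Measurable w)
    (hw1 : Integrable w (jointLaw μ q)) :
    eLpNorm (fun x => weightedRegression q w x - regressionFunction p x) 2 μ ≤
      ENNReal.ofReal F * eLpNorm (fun z => w z - importanceWeight p q z) 2 (jointLaw μ q) := by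
  have him : Measurable (importanceWeight p q) := (Kernel.measurable_rnDeriv p q).ennreal_toReal
  have hdm : Measurable fun z => w z - importanceWeight p q z := hwm.sub him
  -- After squaring, the norm over the joint law disintegrates over `x`. Working in `ENNReal` allows
  -- the right side to be infinite.
  rw [← ENNReal.rpow_le_rpow_iff (z := 2) (by norm_num), eLpNorm_two_rpow_two,
    ENNReal.mul_rpow_of_nonneg _ _ (by norm_num), eLpNorm_two_rpow_two,
    Measure.lintegral_compProd (hdm.enorm.pow_const _), ← lintegral_const_mul _
      (hdm.enorm.pow_const _).lintegral_kernel_prod_right']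
  refine lintegral_mono_ae ?_
  filter_upwards [hpq, Measure.ae_ae_of_ae_compProd hY,
    ((Measure.integrable_compProd_iff hw1.aestronglyMeasurable).1 hw1).1] with x hx hYx hwx
  rw [← eLpNorm_two_rpow_two, ← ENNReal.mul_rpow_of_nonneg _ _ (by norm_num)]
  refine ENNReal.rpow_le_rpow ?_ (by norm_num)
  have hrn : (fun y => importanceWeight p q (x, y)) =ᵐ[q x]
      fun y => ((p x).rnDeriv (q x) y).toReal := by
    filter_upwards [Kernel.rnDeriv_eq_rnDeriv_measure (κ := p) (η := q) (a := x)] with y hy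
    simp [importanceWeight, hy]
  have hiwi : Integrable (fun y => importanceWeight p q (x, y)) (q x) :=
    Measure.integrable_toReal_rnDeriv.congr hrn.symm
  have hmuly : ∀ {u : ℝ → ℝ}, Integrable u (q x) → Integrable (fun y => u y * y) (q x) := by
    intro u hu
    refine (hu.norm.mul_const F).mono' (hu.aestronglyMeasurable.mul
      measurable_id.aestronglyMeasurable) ?_
    filter_upwards [hYx] with y hy
    rw [norm_mul]
    exact mul_le_mul_of_nonneg_left hy (norm_nonneg _)
  -- The change of measure from `p x` to `q x`, where absolute continuity enters.
  have hreg : regressionFunction p x = ∫ y, importanceWeight p q (x, y) * y ∂(q x) := by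
    rw [regressionFunction, ← integral_rnDeriv_smul hx]
    refine integral_congr_ae ?_
    filter_upwards [hrn] with y hy
    rw [hy, smul_eq_mul]
  rw [hreg, weightedRegression, ← integral_sub (hmuly hwx) (hmuly hiwi)]
  calc ‖∫ y, (w (x, y) * y - importanceWeight p q (x, y) * y) ∂(q x)‖ₑ
      ≤ ∫⁻ y, ‖w (x, y) * y - importanceWeight p q (x, y) * y‖ₑ ∂(q x) :=
        enorm_integral_le_lintegral_enorm _
    _ ≤ ∫⁻ y, ENNReal.ofReal F * ‖w (x, y) - importanceWeight p q (x, y)‖ₑ ∂(q x) := by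
        refine lintegral_mono_ae ?_
        filter_upwards [hYx] with y hy
        rw [← sub_mul, enorm_mul, mul_comm]
        gcongr
        rw [Real.enorm_eq_ofReal_abs]
        exact ENNReal.ofReal_le_ofReal hy
    _ = ENNReal.ofReal F * eLpNorm (fun y => w (x, y) - importanceWeight p q (x, y)) 1 (q x) := by
        rw [eLpNorm_one_eq_lintegral_enorm]
        exact lintegral_const_mul _ (hdm.comp measurable_prodMk_left).enorm
    _ ≤ _ := by
        gcongr
        exact eLpNorm_le_eLpNorm_of_exponent_le (by norm_num)
          (hdm.comp measurable_prodMk_left).aestronglyMeasurable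

/-- The bound for the error of an estimator whose excess weighted risk is at most `τ`. -/
theorem eLpNorm_sub_regressionFunction_le {μ : Measure X} [IsProbabilityMeasure μ]
    {p q : Kernel X ℝ} [IsMarkovKernel p] [IsMarkovKernel q] (hpq : ∀ᵐ x ∂μ, p x ≪ q x) {F : ℝ}
    (hF : 0 < F) (hY : ∀ᵐ z ∂(jointLaw μ q), |z.2| ≤ F) {w : X × ℝ → ℝ} (hwm : Measurable w)
    (hw0 : ∀ z, 0 < w z) (hw2 : Integrable (fun z => w z ^ 2) (jointLaw μ q)) {f h : X → ℝ}
    (hf : f ∈ boundedMeasurable X F) (hh : h ∈ boundedMeasurable X F) {τ : ℝ} (hτ : 0 ≤ τ)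
    (hle : ∫ z, w z * (clippedLoss F h z - clippedLoss F f z) ∂(jointLaw μ q) ≤ τ) :
    eLpNorm (fun x => h x - regressionFunction p x) 2 μ ≤
      eLpNorm (fun x => f x - regressionFunction p x) 2 μ
        + ENNReal.ofReal F * eLpNorm (weightBias q w) 1 μ ^ (1 / 2 : ℝ)
        + ENNReal.ofReal (2 * F * √τ)
        + 2 * ENNReal.ofReal F *
          eLpNorm (fun z => w z - importanceWeight p q z) 2 (jointLaw μ q) := by
  have hw1 : Integrable w (jointLaw μ q) :=
    ((memLp_two_iff_integrable_sq hwm.aestronglyMeasurable).2 hw2).integrable one_le_two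
  have hrm := measurable_weightedRegression q hwm
  have hpm := measurable_regressionFunction p
  have hrL : MemLp (weightedRegression q w) 2 μ := memLp_weightedRegression hF hY hwm hw0 hw2
  have hbL : ∀ u ∈ boundedMeasurable X F, MemLp u 2 μ := fun u hu =>
    MemLp.of_bound hu.1.aestronglyMeasurable F (ae_of_all _ hu.2)
  have hD := eLpNorm_weightedRegression_sub_le hpq hY hwm hw1
  set D := ENNReal.ofReal F * eLpNorm (fun z => w z - importanceWeight p q z) 2 (jointLaw μ q)
  have hmid : eLpNorm (fun x => h x - weightedRegression q w x) 2 μ ≤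
      eLpNorm (fun x => f x - weightedRegression q w x) 2 μ
        + ENNReal.ofReal F * eLpNorm (weightBias q w) 1 μ ^ (1 / 2 : ℝ)
        + ENNReal.ofReal (2 * F * √τ) := by
    have hgi : Integrable (weightBias q w) μ := integrable_weightBias hw0 hw1
    have hG : eLpNorm (weightBias q w) 1 μ = ENNReal.ofReal (∫ x, |weightBias q w x| ∂μ) := by
      rw [eLpNorm_one_eq_lintegral_enorm, ← ofReal_integral_norm_eq_lintegral_enorm hgi]
      rfl
    have hG0 : 0 ≤ ∫ x, |weightBias q w x| ∂μ := integral_nonneg fun _ => abs_nonneg _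
    have key := integral_sq_sub_weightedRegression_le hF hY hwm hw0 hw2 hf hh
    have e1 := eLpNorm_two_eq_ofReal_sqrt ((hbL h hh).sub hrL)
    have e2 := eLpNorm_two_eq_ofReal_sqrt ((hbL f hf).sub hrL)
    simp only [Pi.sub_apply] at e1 e2
    change eLpNorm (h - weightedRegression q w) 2 μ ≤
      eLpNorm (f - weightedRegression q w) 2 μ + _ + _
    rw [e1, e2, hG, ENNReal.ofReal_rpow_of_nonneg hG0 (by norm_num), ← Real.sqrt_eq_rpow,
      ← ENNReal.ofReal_mul hF.le, ← ENNReal.ofReal_add (by positivity) (by positivity),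
      ← ENNReal.ofReal_add (by positivity) (by positivity)]
    refine ENNReal.ofReal_le_ofReal ?_
    have hB0 : 0 ≤ ∫ x, (f x - weightedRegression q w x) ^ 2 ∂μ :=
      integral_nonneg fun _ => sq_nonneg _
    set B := ∫ x, (f x - weightedRegression q w x) ^ 2 ∂μ
    set G := ∫ x, |weightBias q w x| ∂μ
    rw [Real.sqrt_le_left (by positivity)]
    have s1 := Real.sq_sqrt hB0
    have s2 := Real.sq_sqrt hG0
    have s3 := Real.sq_sqrt hτ
    have p1 : 0 ≤ √B * (F * √G) := by positivity
    have p2 : 0 ≤ √B * (2 * F * √τ) := by positivity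
    have p3 : 0 ≤ F * √G * (2 * F * √τ) := by positivity
    have hle' : 4 * F ^ 2 * ∫ z, w z * (clippedLoss F h z - clippedLoss F f z) ∂(jointLaw μ q) ≤
        4 * F ^ 2 * τ := by gcongr
    calc _ ≤ B + F ^ 2 * G + 4 * F ^ 2 * τ := by linarith
      _ = √B ^ 2 + F ^ 2 * √G ^ 2 + 4 * F ^ 2 * √τ ^ 2 := by rw [s1, s2, s3]
      _ ≤ _ := by nlinarith
  have tri : ∀ u v s : X → ℝ, Measurable u → Measurable v → Measurable s →
      eLpNorm (fun x => u x - s x) 2 μ ≤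
        eLpNorm (fun x => u x - v x) 2 μ + eLpNorm (fun x => v x - s x) 2 μ := by
    intro u v s hu hv hs
    refine le_trans (le_of_eq ?_) (eLpNorm_add_le (hu.sub hv).aestronglyMeasurable
      (hv.sub hs).aestronglyMeasurable one_le_two)
    congr 1
    ext x
    simp
  have t1 := tri h (weightedRegression q w) (regressionFunction p) hh.1 hrm hpm
  have t2 := tri f (regressionFunction p) (weightedRegression q w) hf.1 hpm hrm
  have hswap : eLpNorm (fun x => regressionFunction p x - weightedRegression q w x) 2 μ =
      eLpNorm (fun x => weightedRegression q w x - regressionFunction p x) 2 μ :=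
    eLpNorm_sub_comm (regressionFunction p) (weightedRegression q w) 2 μ
  rw [hswap] at t2
  set a := eLpNorm (fun x => f x - regressionFunction p x) 2 μ
  set b := ENNReal.ofReal F * eLpNorm (weightBias q w) 1 μ ^ (1 / 2 : ℝ)
  set c := ENNReal.ofReal (2 * F * √τ)
  calc _ ≤ (a + D + b + c) + D := by
        refine t1.trans (add_le_add (hmid.trans ?_) hD)
        gcongr
        exact t2.trans (by gcongr)
    _ = a + b + c + 2 * D := by ring
    _ = _ := by rw [mul_assoc]

end

/-! ### Assembling the error bound. -/

theorem two_mul_sqrt_deviation {F C M : ℝ} (hC : 0 ≤ C) :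
    2 * F * √(2 ^ (5 / 4 : ℝ) * C ^ (3 / 8 : ℝ) * M) =
      (2 : ℝ) ^ (13 / 8 : ℝ) * F * √M * C ^ (3 / 16 : ℝ) := by
  have h1 : √((2 : ℝ) ^ (5 / 4 : ℝ)) = 2 ^ (5 / 8 : ℝ) := by
    rw [Real.sqrt_eq_rpow, ← Real.rpow_mul (by norm_num)]; norm_num
  have h2 : √(C ^ (3 / 8 : ℝ)) = C ^ (3 / 16 : ℝ) := by
    rw [Real.sqrt_eq_rpow, ← Real.rpow_mul hC]; norm_num
  have h3 : (2 : ℝ) ^ (13 / 8 : ℝ) = 2 * 2 ^ (5 / 8 : ℝ) := by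
    rw [show (13 / 8 : ℝ) = 1 + 5 / 8 by norm_num, Real.rpow_add (by norm_num), Real.rpow_one]
  rw [Real.sqrt_mul (by positivity), Real.sqrt_mul (by positivity), h1, h2, h3]
  ring

theorem sum_clippedLoss_nonpos {X : Type*} {N : ℕ} (hN : 0 < N) {F : ℝ} (hF : 0 < F)
    {H : Set (X → ℝ)} (hH : ∀ f ∈ H, ∀ x, |f x| ≤ F) {w : X × ℝ → ℝ} {D : Fin N → X × ℝ}
    (hD : ∀ i, |(D i).2| ≤ F) {h : X → ℝ} (hh : IsWeightedERM H w D h) {f : X → ℝ} (hf : f ∈ H) :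
    ∑ i, w (D i) * (clippedLoss F h (D i) - clippedLoss F f (D i)) ≤ 0 := by
  have hN' : (0 : ℝ) < N := by exact_mod_cast hN
  have h1 := le_of_mul_le_mul_left (hh.2 f hf) (by positivity)
  rw [← sub_nonpos, ← Finset.sum_sub_distrib] at h1
  have h2 : ∑ i, (w (D i) * squaredLoss h (D i) - w (D i) * squaredLoss f (D i)) =
      4 * F ^ 2 * ∑ i, w (D i) * (clippedLoss F h (D i) - clippedLoss F f (D i)) := by
    rw [Finset.mul_sum]
    refine Finset.sum_congr rfl fun i _ => ?_
    rw [squaredLoss_eq_mul_clippedLoss hF (hH h hh.1) (hD i),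
      squaredLoss_eq_mul_clippedLoss hF (hH f hf) (hD i)]
    ring
  rw [h2] at h1
  exact nonpos_of_mul_nonpos_right h1 (by positivity)

/-- The failure probability of the error bound relative to one competitor `f`. -/
theorem measure_error_lt_le {X : Type*} [MeasurableSpace X]
    (μ : Measure X) [IsProbabilityMeasure μ] (p q : Kernel X ℝ) [IsMarkovKernel p]
    [IsMarkovKernel q] (hpq : ∀ᵐ x ∂μ, p x ≪ q x) {F : ℝ} (hF : 0 < F)
    (hY : ∀ᵐ z ∂(jointLaw μ q), |z.2| ≤ F) {H : Set (X → ℝ)} (hH : H ⊆ boundedMeasurable X F)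
    {w : X × ℝ → ℝ} (hwm : Measurable w) (hw0 : ∀ z, 0 < w z)
    (hw2 : Integrable (fun z => w z ^ 2) (jointLaw μ q)) {d : ℕ}
    (hd : pseudoDim (squaredLoss '' H) ≤ d) {N : ℕ} (hN : 0 < N) (hdN : d ≤ 2 * N)
    {hhat : (Fin N → X × ℝ) → X → ℝ} (hhat_meas : Measurable (Function.uncurry hhat))
    (hhat_erm : ∀ᵐ D ∂(Measure.pi fun _ : Fin N => jointLaw μ q), IsWeightedERM H w D (hhat D))
    {δ : ℝ} (hδ : 0 < δ) (hδ2 : δ < 1 / 2) {f : X → ℝ} (hf : f ∈ H) :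
    (Measure.pi fun _ : Fin N => jointLaw μ q)
      {D | eLpNorm (fun x => f x - regressionFunction p x) 2 μ
          + ENNReal.ofReal F * eLpNorm (weightBias q w) 1 μ ^ (1 / 2 : ℝ)
          + ENNReal.ofReal ((2 : ℝ) ^ (13 / 8 : ℝ) * F * √(momentTerm (jointLaw μ q) w D)
              * complexityTerm d N δ ^ (3 / 16 : ℝ))
          + 2 * ENNReal.ofReal F *
              eLpNorm (fun z => w z - importanceWeight p q z) 2 (jointLaw μ q) <
          eLpNorm (fun x => hhat D x - regressionFunction p x) 2 μ} ≤ ENNReal.ofReal (2 * δ) := by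
  have hC := complexityTerm_pos hN hdN hδ hδ2
  have hbdd : ∀ᵐ D ∂(Measure.pi fun _ : Fin N => jointLaw μ q), ∀ i, |(D i).2| ≤ F :=
    ae_all_iff.2 fun i =>
      (measurePreserving_eval (fun _ : Fin N => jointLaw μ q) i).quasiMeasurePreserving.ae hY
  have hûm : Measurable (Function.uncurry fun D : Fin N → X × ℝ => clippedLoss F (hhat D)) := by
    have h1 : Measurable fun a : (Fin N → X × ℝ) × (X × ℝ) => hhat a.1 a.2.1 :=
      hhat_meas.comp (measurable_fst.prodMk (measurable_fst.comp measurable_snd))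
    have h2 : Measurable fun a : (Fin N → X × ℝ) × (X × ℝ) =>
        min ((hhat a.1 a.2.1 - a.2.2) ^ 2 / (4 * F ^ 2)) 1 := by fun_prop
    convert h2 using 2 with a
    simp [Function.uncurry, clippedLoss, squaredLoss]
  have hdev := weighted_erm_deviation (jointLaw μ q) hwm hw0 hw2 (U := clippedLoss F '' H)
    (by rintro _ ⟨u, hu, rfl⟩; exact measurable_clippedLoss F (hH hu).1)
    (by rintro _ ⟨u, hu, rfl⟩; exact clippedLoss_mem_Icc F u)
    ((pseudoDim_clippedLoss_le hF H).trans hd) hN hdN ⟨f, hf, rfl⟩ hûm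
    (by
      filter_upwards [hbdd, hhat_erm] with D hD hE
      exact ⟨⟨_, hE.1, rfl⟩, sum_clippedLoss_nonpos hN hF (fun u hu => (hH hu).2) hD hE hf⟩) hδ
  refine (measure_mono_ae ?_).trans hdev
  -- Contrapositive: if the excess risk is within the deviation bound, the deterministic estimate
  -- gives the error bound.
  filter_upwards [hhat_erm] with D hE hD
  by_contra hle
  refine not_le.2 hD ?_
  have hM : 0 ≤ momentTerm (jointLaw μ q) w D :=
    add_nonneg (Real.sqrt_nonneg _) (Real.sqrt_nonneg _)
  have := eLpNorm_sub_regressionFunction_le hpq hF hY hwm hw0 hw2 (hH hf) (hH hE.1)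
    (by positivity) (not_lt.1 hle)
  rwa [two_mul_sqrt_deviation hC.le] at this

end WeightedRegression

open WeightedRegression in
theorem theorem2 {X : Type*} [MeasurableSpace X]
    (μ : Measure X) [IsProbabilityMeasure μ]
    (p q : Kernel X ℝ) [IsMarkovKernel p] [IsMarkovKernel q]
    (hpq : ∀ᵐ x ∂μ, p x ≪ q x)
    (Fmax : ℝ) (hF : 0 < Fmax)
    (hY : ∀ᵐ z ∂(jointLaw μ q), |z.2| ≤ Fmax)
    (H : Set (X → ℝ)) (hH : H ⊆ boundedMeasurable X Fmax)
    (wt : X × ℝ → ℝ) (hwt_meas : Measurable wt) (hwt_pos : ∀ z, 0 < wt z)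
    (hwt_sq : Integrable (fun z => wt z ^ 2) (jointLaw μ q))
    (d : ℕ) (hd : pseudoDim (squaredLoss '' H) = (d : ℕ∞))
    (N : ℕ) (hN : 0 < N) (hdN : d ≤ 2 * N)
    (hhat : (Fin N → X × ℝ) → X → ℝ)
    (hhat_meas : Measurable (Function.uncurry hhat))
    (hhat_erm : ∀ᵐ D ∂(Measure.pi fun _ : Fin N => jointLaw μ q), IsWeightedERM H wt D (hhat D))
    (δ : ℝ) (hδ : 0 < δ) :
    1 - 2 * δ ≤ (Measure.pi fun _ : Fin N => jointLaw μ q).real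
      {D | eLpNorm (fun x => hhat D x - regressionFunction p x) 2 μ ≤
          (⨅ f ∈ H, eLpNorm (fun x => f x - regressionFunction p x) 2 μ)
          + ENNReal.ofReal Fmax * eLpNorm (weightBias q wt) 1 μ ^ (1 / 2 : ℝ)
          + ENNReal.ofReal ((2 : ℝ) ^ (13 / 8 : ℝ) * Fmax * √(momentTerm (jointLaw μ q) wt D)
              * complexityTerm d N δ ^ (3 / 16 : ℝ))
          + 2 * ENNReal.ofReal Fmax *
              eLpNorm (fun z => wt z - importanceWeight p q z) 2 (jointLaw μ q)} := by
  set ν := Measure.pi fun _ : Fin N => jointLaw μ q with hν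
  set I := ⨅ f ∈ H, eLpNorm (fun x => f x - regressionFunction p x) 2 μ with hI
  set b := ENNReal.ofReal Fmax * eLpNorm (weightBias q wt) 1 μ ^ (1 / 2 : ℝ)
  set c : (Fin N → X × ℝ) → ENNReal := fun D =>
    ENNReal.ofReal ((2 : ℝ) ^ (13 / 8 : ℝ) * Fmax * √(momentTerm (jointLaw μ q) wt D)
      * complexityTerm d N δ ^ (3 / 16 : ℝ))
  set e := 2 * ENNReal.ofReal Fmax *
    eLpNorm (fun z => wt z - importanceWeight p q z) 2 (jointLaw μ q)
  set err : (Fin N → X × ℝ) → ENNReal := fun D =>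
    eLpNorm (fun x => hhat D x - regressionFunction p x) 2 μ
  change 1 - 2 * δ ≤ ν.real {D | err D ≤ I + b + c D + e}
  rcases le_or_gt (1 / 2) δ with hδ2 | hδ2
  · exact (by linarith : 1 - 2 * δ ≤ 0).trans measureReal_nonneg
  -- The infimum need not be attained. With slack `1/n` a single competitor suffices, and since the
  -- failure events increase with `n`, their union obeys the same bound `2δ`.
  have hunion : {D | err D ≤ I + b + c D + e}ᶜ ⊆
      ⋃ n : ℕ, {D | I + (n : ENNReal)⁻¹ + b + c D + e < err D} := by
    intro D hD
    have hlt : I + 0 + b + c D + e < err D := by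
      rw [add_zero]; exact not_le.1 hD
    have ht : Filter.Tendsto (fun n : ℕ => I + (n : ENNReal)⁻¹ + b + c D + e) Filter.atTop
        (nhds (I + 0 + b + c D + e)) :=
      (((tendsto_const_nhds.add ENNReal.tendsto_inv_nat_nhds_zero).add
        tendsto_const_nhds).add tendsto_const_nhds).add tendsto_const_nhds
    exact Set.mem_iUnion.2 (ht.eventually (gt_mem_nhds hlt)).exists
  have hmono : Monotone fun n : ℕ => {D | I + (n : ENNReal)⁻¹ + b + c D + e < err D} := by
    intro m n hmn D hD
    refine lt_of_le_of_lt (b := I + (m : ENNReal)⁻¹ + b + c D + e) ?_ hD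
    gcongr
  have hcompl : ν {D | err D ≤ I + b + c D + e}ᶜ ≤ ENNReal.ofReal (2 * δ) := by
    refine (measure_mono hunion).trans ?_
    rw [hmono.measure_iUnion]
    refine iSup_le fun n => ?_
    -- An infinite infimum, as for an empty class, makes the failure event empty.
    by_cases hItop : I = ⊤
    · simp [hItop]
    obtain ⟨f, hfH, hf⟩ : ∃ f ∈ H, eLpNorm (fun x => f x - regressionFunction p x) 2 μ <
        I + (n : ENNReal)⁻¹ := by
      have h := ENNReal.lt_add_right hItop (show ((n : ENNReal)⁻¹) ≠ 0 by simp)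
      rw [hI] at h
      simpa only [iInf_lt_iff, exists_prop] using h
    refine le_trans (measure_mono fun D hD => ?_)
      (measure_error_lt_le μ p q hpq hF hY hH hwt_meas hwt_pos hwt_sq hd.le hN hdN hhat_meas
        hhat_erm hδ hδ2 hfH)
    refine lt_of_le_of_lt (b := I + (n : ENNReal)⁻¹ + b + c D + e) ?_ hD
    gcongr
  have hone := measureReal_union_le (μ := ν) {D | err D ≤ I + b + c D + e}
    {D | err D ≤ I + b + c D + e}ᶜ
  rw [Set.union_compl_self, probReal_univ] at hone
  have h2 : ν.real {D | err D ≤ I + b + c D + e}ᶜ ≤ 2 * δ :=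
    ENNReal.toReal_le_of_le_ofReal (by positivity) hcompl
  linarith
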